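/- Consider chains of $n$ spins, each with Hilbert space $\mathbb C^d$. For a unit vector $|\psi\rangle\in(\mathbb C^d)^{\otimes n}$, $0<\alpha<1$ and $1\le k\le n-1$, let $\rho_k$ be the reduced density matrix of $|\psi\rangle\langle\psi|$ on the first $k$ spins, and let $\frac{1}{1-\alpha}\log\operatorname{tr}\rho_k^\alpha$ be the Rényi entanglement entropy of order $\alpha$ across the cut $k|k+1$. Say that $|\psi\rangle$ satisfies a Rényi-$\alpha$ area law with bound $R\ge0$ if this entropy is at most $R$ for every cut. A matrix product operator (MPO) is an operator $$\rho=\sum_{i_1,j_1,\dots,i_n,j_n=1}^{d}\bigl(A^{[1]}_{i_1,j_1}A^{[2]}_{i_2,j_2}\cdots A^{[n]}_{i_n,j_n}\bigr)\,|i_1\cdots i_n\rangle\langle j_1\cdots j_n|,$$ where $A^{[k]}_{i,j}$ is a complex $D_k\times D_{k+1}$ matrix and $D_1=D_{n+1}=1$; its bond dimension is $\max_k D_k$. **Theorem.** Fix $d$, $\ell$ and $M$. An operator $\hat O$ on the chain is called admissible if it acts on at most $\ell$ consecutive spins (as the identity on all others) and has operator norm $\|\hat O\|\le M$. (1) There is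 a constant $C>0$, depending only on $d,\ell,M$, such that for all $0<\alpha<1$, $R_\alpha\ge0$, $n$, $0<\delta\le1$ and every unit vector $|\psi\rangle\in(\mathbb C^d)^{\otimes n}$ that satisfies a Rényi-$\alpha$ area law with bound $R_\alpha$, there is a positive semidefinite MPO $\rho$ of bond dimension at most $$\exp(2R_\alpha)\,(C/\delta)^{4\alpha/(1-\alpha)}$$ with $\bigl|\langle\psi|\hat O|\psi\rangle-\operatorname{tr}(\rho\hat O)\bigr|\le\delta$ for every admissible $\hat O$. (2) Let bounds $R_\alpha\ge0$ be given for all $0<\alpha<1$. Then there is a function $B$, depending only on $d,\ell,M$ and the family $(R_\alpha)_\alpha$ (and not on $n$), with $B(t)=o(t^c)$ as $t\to\infty$ for every $c>0$, such that for all $n$, all $0<\delta\le1$ and every unit vector $|\psi\rangle\in(\mathbb C^d)^{\otimes n}$ that satisfies a Rényi-$\alpha$ area law with bound $R_\alpha$ for every $\alpha\in(0,1)$, there is a positive semidefinite MPO $\rho$ of bond dimension at most $B(1/\delta)$ with $\bigl|\langle\psi|\hat O|\psi\rangle-\operatorname{tr}(\rho\hat O)\bigr|\le\delta$ for every admissible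 $\hat O$. -/

import Mathlib

open scoped ComplexOrder

noncomputable section

namespace SpinChain

/-- Basis configurations of a chain of `n` spins of local dimension `d`. -/
abbrev Config (n d : ℕ) : Type := Fin n → Fin d

/-- The Hilbert space `(ℂ^d)^{⊗ n}`, in the computational basis. -/
abbrev State (n d : ℕ) : Type := EuclideanSpace ℂ (Config n d)

/-- Operators on `(ℂ^d)^{⊗ n}`, as matrices in the computational basis. -/
abbrev Op (n d : ℕ) : Type := Matrix (Config n d) (Config n d) ℂ

/-- The operator norm with respect to the Euclidean norm. -/
def opNorm {n d : ℕ} (O : Op n d) : ℝ :=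
  ‖Matrix.toEuclideanCLM (n := Config n d) (𝕜 := ℂ) O‖

/-- The expectation value `⟨ψ|O|ψ⟩`. -/
def expect {n d : ℕ} (ψ : State n d) (O : Op n d) : ℂ :=
  inner ℂ ψ (Matrix.toEuclideanCLM (n := Config n d) (𝕜 := ℂ) O ψ)

/-! ### Entanglement across a cut -/

/-- The coefficients of `ψ` as a matrix: rows are configurations of the first `k` spins,
columns are configurations of the remaining spins. -/
def cutMatrix {n d : ℕ} (ψ : State n d) (k : ℕ) :
    Matrix ({i : Fin n // i.val < k} → Fin d) ({i : Fin n // ¬ i.val < k} → Fin d) ℂ :=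
  Matrix.of fun a b =>
    ψ ((Equiv.piEquivPiSubtypeProd (fun i : Fin n => i.val < k) (fun _ => Fin d)).symm (a, b))

/-- The reduced density matrix of `|ψ⟩⟨ψ|` on the first `k` spins. -/
def reducedDensity {n d : ℕ} (ψ : State n d) (k : ℕ) :
    Matrix ({i : Fin n // i.val < k} → Fin d) ({i : Fin n // i.val < k} → Fin d) ℂ :=
  cutMatrix ψ k * (cutMatrix ψ k).conjTranspose

theorem reducedDensity_isHermitian {n d : ℕ} (ψ : State n d) (k : ℕ) :
    (reducedDensity ψ k).IsHermitian :=
  Matrix.isHermitian_mul_conjTranspose_self (cutMatrix ψ k)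

/-- The Rényi entanglement entropy `(1 - α)⁻¹ log tr (ρ_A ^ α)`, where `A` consists of the first
`k` spins; `tr (ρ_A ^ α)` is the sum of the `α`-th powers of the eigenvalues of `ρ_A`. -/
def renyiEntropy {n d : ℕ} (α : ℝ) (ψ : State n d) (k : ℕ) : ℝ :=
  (1 - α)⁻¹ * Real.log (∑ i, (reducedDensity_isHermitian ψ k).eigenvalues i ^ α)

/-- `R` bounds the Rényi entanglement entropy of order `α` of `ψ` across every cut of the chain
into two nonempty pieces. -/
def RenyiAreaLaw {n d : ℕ} (α R : ℝ) (ψ : State n d) : Prop :=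
  ∀ k : ℕ, 0 < k → k < n → renyiEntropy α ψ k ≤ R

/-! ### Local operators -/

/-- `O = P ⊗ 1` with `P` acting on the spins in `S` and the identity acting on the others. -/
def ActsOn {n d : ℕ} (S : Finset (Fin n)) (O : Op n d) : Prop :=
  ∃ P : Matrix (S → Fin d) (S → Fin d) ℂ, ∀ x y : Config n d,
    O x y = if ∀ i, i ∉ S → x i = y i then P (fun i => x i) (fun i => y i) else 0

/-- `O` acts on (at most) `ℓ` consecutive spins. -/
def IsLocal {n d : ℕ} (ℓ : ℕ) (O : Op n d) : Prop :=
  ∃ a : ℕ, ActsOn (Finset.univ.filter fun i : Fin n => a ≤ i.val ∧ i.val < a + ℓ) O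

/-! ### Matrix product operators -/

/-- A matrix product operator with open boundary conditions, with respect to the basis
`|i⟩⟨j|` of the operators on a spin. Spins are numbered `0, …, n - 1`; `bond k` and `bond (k + 1)`
are the dimensions of the bonds to the left and right of spin `k`
(only the values of `bond` at `0, …, n` matter). -/
structure MPO (n d : ℕ) where
  bond : ℕ → ℕ
  bond_pos : ∀ k, k ≤ n → 0 < bond k
  bond_zero : bond 0 = 1
  bond_last : bond n = 1
  tensor : (k : Fin n) → Fin d → Fin d → Matrix (Fin (bond k)) (Fin (bond (k + 1))) ℂ

/-- The product of the matrices of the first `m` spins. -/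
def MPO.leftProd {n d : ℕ} (K : MPO n d) (x y : Config n d) :
    (m : ℕ) → m ≤ n → Matrix (Fin (K.bond 0)) (Fin (K.bond m)) ℂ
  | 0, _ => 1
  | m + 1, h =>
    MPO.leftProd K x y m (Nat.le_of_succ_le h) *
      K.tensor ⟨m, h⟩ (x ⟨m, h⟩) (y ⟨m, h⟩)

/-- The operator represented by an MPO: its entry `⟨x|K|y⟩` is the unique entry of the `1 × 1`
matrix that is the product of the matrices of all spins. -/
def MPO.toOp {n d : ℕ} (K : MPO n d) : Op n d :=
  Matrix.of fun x y =>
    K.leftProd x y n le_rfl ⟨0, K.bond_pos 0 (Nat.zero_le n)⟩ ⟨0, K.bond_pos n le_rfl⟩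

/-- The bond dimension: the maximum of the dimensions of all bonds. -/
def MPO.bondDim {n d : ℕ} (K : MPO n d) : ℕ :=
  (Finset.range (n + 1)).sup K.bond

/-- The expectation of every operator on `ℓ` consecutive spins of norm at most `M` in `K` is
within `δ` of its expectation in `ψ`. -/
def MPO.ApproximatesLocally {n d : ℕ} (K : MPO n d) (ψ : State n d) (ℓ : ℕ) (M δ : ℝ) : Prop :=
  ∀ O : Op n d, IsLocal ℓ O → opNorm O ≤ M → ‖expect ψ O - (K.toOp * O).trace‖ ≤ δ

end SpinChain

end

/-! The area law says that at each cut `k` the reduced density matrix `Λ` of `ψ` is carried, up to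
weight `ε`, by a projection `P` of rank at most `exp R * (1 / ε) ^ (α / (1 - α))`. Truncating by
such projections at every cut naively would accumulate an error proportional to the length of the
chain. The point is to truncate so that a local operator notices only the cuts near its support.

This is done by `exists_truncation`. Let `X` be a positive operator whose left marginal is dominated
by `Λ`. Compress `X` to `c P X P` and add a product operator `τ ⊗ Y`. The right factor `Y` is
exactly what the compression takes away from the right marginal, and `τ` is the normalized gap
between `c P Λ P` and the left marginal of `c P X P`. Afterwards the right marginal is unchanged,
and the left marginal is `c P Λ P`, whatever `X` was: past errors are forgotten on the left. By
gentle measurement, any bounded operator moves by `O(√ε)`.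

The cuts are treated from right to left. Since `c P Λ P ≤ Λ`, tracing out one more spin gives the
domination needed at the next cut. An operator on `ℓ` consecutive spins pays once when a cut to the
right of its support resets the state, at most `ℓ` times for cuts meeting its support, and never
again (`exists_locally_close_of_isFilter`). The total error `O(ℓ M √ε)` does not depend on `n`.

Truncation at `k` bounds the operator Schmidt rank there by the square of the rank of `P`, and later
truncations act linearly on spins further left, so they preserve this bound. Bounded Schmidt ranks
at all cuts give an MPO (`exists_MPO_of_schmidtRankLE`). Part (1) takes `ε` of order `δ ^ 2`; part
(2) takes the infimum of the bounds over all `α`. -/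

noncomputable section

namespace SpinChain

open Matrix
open scoped Kronecker

/-! ### Partial traces and the truncation that repairs both marginals -/

section PartialTrace

variable {A B : Type*} [Fintype A] [Fintype B]

/-- The partial trace over the second tensor factor. -/
def traceRight (X : Matrix (A × B) (A × B) ℂ) : Matrix A A ℂ :=
  Matrix.of fun a b => ∑ z, X (a, z) (b, z)

/-- The partial trace over the first tensor factor. -/
def traceLeft (X : Matrix (A × B) (A × B) ℂ) : Matrix B B ℂ :=
  Matrix.of fun z w => ∑ a, X (a, z) (a, w)

omit [Fintype A] in
theorem traceRight_apply (X : Matrix (A × B) (A × B) ℂ) (a b : A) :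
    traceRight X a b = ∑ z, X (a, z) (b, z) := rfl

omit [Fintype B] in
theorem traceLeft_apply (X : Matrix (A × B) (A × B) ℂ) (z w : B) :
    traceLeft X z w = ∑ a, X (a, z) (a, w) := rfl

omit [Fintype A] in
theorem traceRight_add (X Y : Matrix (A × B) (A × B) ℂ) :
    traceRight (X + Y) = traceRight X + traceRight Y := by
  ext a b; simp [traceRight_apply, Finset.sum_add_distrib]

omit [Fintype A] in
theorem traceRight_sub (X Y : Matrix (A × B) (A × B) ℂ) :
    traceRight (X - Y) = traceRight X - traceRight Y := by
  ext a b; simp [traceRight_apply, Finset.sum_sub_distrib]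

omit [Fintype A] in
theorem traceRight_smul (c : ℂ) (X : Matrix (A × B) (A × B) ℂ) :
    traceRight (c • X) = c • traceRight X := by
  ext a b; simp [traceRight_apply, Finset.mul_sum]

theorem trace_traceRight (X : Matrix (A × B) (A × B) ℂ) :
    (traceRight X).trace = X.trace := by
  simp [Matrix.trace, traceRight_apply, Fintype.sum_prod_type]

omit [Fintype A] in
theorem traceRight_kronecker (Y : Matrix A A ℂ) (Z : Matrix B B ℂ) :
    traceRight (Y ⊗ₖ Z) = Z.trace • Y := by
  ext a b
  simp [traceRight_apply, Matrix.trace, ← Finset.mul_sum, mul_comm]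

omit [Fintype B] in
theorem posSemidef_traceLeft {X : Matrix (A × B) (A × B) ℂ} (hX : X.PosSemidef) :
    (traceLeft X).PosSemidef := by
  have h : traceLeft X = ∑ a, X.submatrix (fun z => (a, z)) (fun z => (a, z)) := by
    ext a b; simp [traceLeft_apply, Matrix.sum_apply]
  rw [h]
  exact Matrix.posSemidef_sum _ fun z _ => hX.submatrix _

variable [DecidableEq A] [DecidableEq B]

omit [DecidableEq A] in
theorem kronecker_one_mul_apply (P : Matrix A A ℂ) (X : Matrix (A × B) (A × B) ℂ)
    (a : A) (z : B) (q : A × B) :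
    ((P ⊗ₖ (1 : Matrix B B ℂ)) * X) (a, z) q = ∑ a', P a a' * X (a', z) q := by
  simp [Matrix.mul_apply, Fintype.sum_prod_type, Matrix.one_apply]

omit [DecidableEq A] in
theorem mul_kronecker_one_apply (P : Matrix A A ℂ) (X : Matrix (A × B) (A × B) ℂ)
    (q : A × B) (b : A) (w : B) :
    (X * (P ⊗ₖ (1 : Matrix B B ℂ))) q (b, w) = ∑ b', X q (b', w) * P b' b := by
  simp [Matrix.mul_apply, Fintype.sum_prod_type, Matrix.one_apply]

omit [DecidableEq A] in
theorem kronecker_one_conj_apply (P Q : Matrix A A ℂ) (X : Matrix (A × B) (A × B) ℂ)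
    (a b : A) (z w : B) :
    ((P ⊗ₖ (1 : Matrix B B ℂ)) * X * (Q ⊗ₖ (1 : Matrix B B ℂ))) (a, z) (b, w) =
      ∑ a', ∑ b', P a a' * Q b' b * X (a', z) (b', w) := by
  rw [mul_kronecker_one_apply, Finset.sum_comm]
  refine Finset.sum_congr rfl fun b' _ => ?_
  rw [kronecker_one_mul_apply, Finset.sum_mul]
  exact Finset.sum_congr rfl fun a' _ => by ring

omit [DecidableEq A] in
theorem traceRight_conj (P Q : Matrix A A ℂ) (X : Matrix (A × B) (A × B) ℂ) :
    traceRight ((P ⊗ₖ (1 : Matrix B B ℂ)) * X * (Q ⊗ₖ (1 : Matrix B B ℂ))) =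
      P * traceRight X * Q := by
  ext a b
  rw [traceRight_apply, Matrix.mul_apply]
  simp only [kronecker_one_conj_apply]
  simp only [Matrix.mul_apply, traceRight_apply, Finset.sum_mul, Finset.mul_sum]
  rw [Finset.sum_comm]
  conv_rhs => rw [Finset.sum_comm]
  refine Finset.sum_congr rfl fun a' _ => ?_
  rw [Finset.sum_comm]
  exact Finset.sum_congr rfl fun b' _ => Finset.sum_congr rfl fun z _ => by ring

omit [DecidableEq A] in
theorem trace_mul_kronecker_one (X : Matrix (A × B) (A × B) ℂ) (Y : Matrix A A ℂ) :
    (X * (Y ⊗ₖ (1 : Matrix B B ℂ))).trace = (traceRight X * Y).trace := by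
  simp only [Matrix.trace, Matrix.diag, Fintype.sum_prod_type, mul_kronecker_one_apply]
  simp only [Matrix.mul_apply, traceRight_apply, Finset.sum_mul]
  exact Finset.sum_congr rfl fun a _ => Finset.sum_comm

omit [DecidableEq B] in
theorem mul_one_kronecker_apply (Z : Matrix B B ℂ) (X : Matrix (A × B) (A × B) ℂ)
    (q : A × B) (b : A) (w : B) :
    (X * ((1 : Matrix A A ℂ) ⊗ₖ Z)) q (b, w) = ∑ w', X q (b, w') * Z w' w := by
  simp [Matrix.mul_apply, Fintype.sum_prod_type_right, Matrix.one_apply]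

omit [DecidableEq B] in
theorem trace_mul_one_kronecker (X : Matrix (A × B) (A × B) ℂ) (Z : Matrix B B ℂ) :
    (X * ((1 : Matrix A A ℂ) ⊗ₖ Z)).trace = (traceLeft X * Z).trace := by
  simp only [Matrix.trace, Matrix.diag, Fintype.sum_prod_type_right, mul_one_kronecker_apply]
  simp only [Matrix.mul_apply, traceLeft_apply, Finset.sum_mul]
  exact Finset.sum_congr rfl fun a _ => Finset.sum_comm

/-- Given a projection `P` on the first factor and a density matrix `Λ` that dominates the reduced
one of `X`, the truncation of `X` by `P` can be completed, by adding a product operator, such that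
the reduced density matrix becomes that of the truncation of `Λ` and nothing changes on the second
factor. The result arises from `X` by a linear map on the first factor. -/
theorem exists_truncation {X : Matrix (A × B) (A × B) ℂ} (hX : X.PosSemidef)
    {Λ P : Matrix A A ℂ} (hP : P.IsHermitian) (hPP : P * P = P) {c : ℝ} (hc0 : 0 ≤ c)
    (hc1 : c ≤ 1) (hle : (Λ - traceRight X).PosSemidef)
    (htr : (c : ℂ) * (P * Λ).trace = X.trace) :
    ∃ X' : Matrix (A × B) (A × B) ℂ,
      traceRight X' = (c : ℂ) • (P * Λ * P) ∧
      (X' - (c : ℂ) • ((P ⊗ₖ (1 : Matrix B B ℂ)) * X * (P ⊗ₖ (1 : Matrix B B ℂ)))).PosSemidef ∧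
      (P ⊗ₖ (1 : Matrix B B ℂ)) * X' * (P ⊗ₖ (1 : Matrix B B ℂ)) = X' ∧
      (∀ Z : Matrix B B ℂ, (X' * ((1 : Matrix A A ℂ) ⊗ₖ Z)).trace =
        (X * ((1 : Matrix A A ℂ) ⊗ₖ Z)).trace) ∧
      ∃ κ : A → A → A → A → ℂ, ∀ a z b w,
        X' (a, z) (b, w) = ∑ a', ∑ b', κ a b a' b' * X (a', z) (b', w) := by
  have hcC : (0 : ℂ) ≤ (c : ℂ) := by exact_mod_cast hc0
  set Pt : Matrix (A × B) (A × B) ℂ := P ⊗ₖ (1 : Matrix B B ℂ) with hPt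
  -- `G` is the positive square root of `1 - c P`, so that `Y` below is manifestly positive while
  -- representing the weight that `c P X P` loses on the second factor.
  set G : Matrix A A ℂ := (1 - P) + ((Real.sqrt (1 - c) : ℝ) : ℂ) • P with hG
  have hsq : ((Real.sqrt (1 - c) : ℝ) : ℂ) * ((Real.sqrt (1 - c) : ℝ) : ℂ) = 1 - (c : ℂ) := by
    rw [← Complex.ofReal_mul, Real.mul_self_sqrt (by linarith)]; push_cast; rfl
  have hGG : G * G = 1 - (c : ℂ) • P := by
    simp only [hG, add_mul, mul_add, sub_mul, mul_sub, one_mul, mul_one, smul_mul_smul_comm,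
      Matrix.smul_mul, Matrix.mul_smul, hPP, hsq]
    module
  have hGH : G.IsHermitian := by
    refine IsHermitian.add (IsHermitian.sub isHermitian_one hP) ?_
    unfold IsHermitian
    rw [conjTranspose_smul, hP.eq]; simp
  set Gt : Matrix (A × B) (A × B) ℂ := G ⊗ₖ (1 : Matrix B B ℂ) with hGt
  have hGtH : Gt.IsHermitian := by
    unfold IsHermitian
    rw [hGt, conjTranspose_kronecker, hGH.eq, conjTranspose_one]
  set Y : Matrix B B ℂ := traceLeft (Gt * X * Gt) with hY
  have hYpos : Y.PosSemidef := posSemidef_traceLeft (by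
    have := hX.mul_mul_conjTranspose_same Gt
    rwa [hGtH.eq] at this)
  -- What is missing on the first factor: `c P Λ P` minus the reduced matrix of `c P X P`. The
  -- hypothesis `htr` makes its trace agree with that of `Y`, so a single product operator repairs
  -- both marginals.
  set D : Matrix A A ℂ := (c : ℂ) • (P * (Λ - traceRight X) * P) with hD
  have hDpos : D.PosSemidef := by
    have := (hle.mul_mul_conjTranspose_same P).smul hcC
    rwa [hP.eq] at this
  have hYZ : ∀ Z : Matrix B B ℂ, (Y * Z).trace =
      (X * ((1 : Matrix A A ℂ) ⊗ₖ Z)).trace - (c : ℂ) * (X * (P ⊗ₖ Z)).trace := by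
    intro Z
    rw [hY, ← trace_mul_one_kronecker, Matrix.mul_assoc (Gt * X), Matrix.mul_assoc Gt,
      Matrix.trace_mul_comm Gt, Matrix.mul_assoc X, Matrix.mul_assoc Gt, hGt, ← mul_kronecker_mul,
      ← mul_kronecker_mul, one_mul, one_mul, mul_one, hGG]
    have : (1 - (c : ℂ) • P) ⊗ₖ Z = (1 : Matrix A A ℂ) ⊗ₖ Z - (c : ℂ) • (P ⊗ₖ Z) := by
      ext ⟨a, z⟩ ⟨b, w⟩; simp [sub_mul, mul_assoc]
    rw [this, mul_sub, Matrix.trace_sub, Matrix.mul_smul, Matrix.trace_smul, smul_eq_mul]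
  have hPZ : ∀ Z : Matrix B B ℂ, (Pt * X * Pt * ((1 : Matrix A A ℂ) ⊗ₖ Z)).trace =
      (X * (P ⊗ₖ Z)).trace := by
    intro Z
    rw [Matrix.mul_assoc (Pt * X), Matrix.mul_assoc Pt,
      Matrix.trace_mul_comm Pt, Matrix.mul_assoc X, Matrix.mul_assoc Pt, hPt, ← mul_kronecker_mul,
      ← mul_kronecker_mul, one_mul, one_mul, mul_one, hPP]
  have hYD : Y.trace = D.trace := by
    have h1 := hYZ 1
    rw [mul_one, one_kronecker_one, mul_one, trace_mul_kronecker_one] at h1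
    rw [h1, ← htr, hD, Matrix.trace_smul, Matrix.trace_mul_comm (P * (Λ - traceRight X)) P,
      ← Matrix.mul_assoc, hPP, mul_sub,
      Matrix.trace_sub, Matrix.trace_mul_comm (traceRight X) P, smul_eq_mul]
    ring
  -- If `D` has trace zero then `D` and `Y` vanish by positivity, and the convention `0⁻¹ = 0` gives
  -- the correct `τ = 0`.
  set τ : Matrix A A ℂ := (D.trace)⁻¹ • D with hτ
  have hτpos : τ.PosSemidef := hDpos.smul (by
    rw [Complex.nonneg_iff.1 hDpos.trace_nonneg |>.2 |> fun h => (Complex.ext rfl h.symm :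
      D.trace = ((D.trace.re : ℝ) : ℂ)), ← Complex.ofReal_inv]
    have := (Complex.nonneg_iff.1 hDpos.trace_nonneg).1
    exact_mod_cast inv_nonneg.2 this)
  have hτD : D.trace • τ = D := by
    by_cases h : D.trace = 0
    · rw [hDpos.trace_eq_zero_iff.1 h]; simp
    · rw [hτ, smul_smul, mul_inv_cancel₀ h, one_smul]
  have hPτ : P * τ * P = τ := by
    have : P * D * P = D := by
      rw [hD, Matrix.mul_smul, Matrix.smul_mul]
      congr 1
      rw [Matrix.mul_assoc, Matrix.mul_assoc _ P P, hPP, ← Matrix.mul_assoc, ← Matrix.mul_assoc, hPP]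
    rw [hτ, Matrix.mul_smul, Matrix.smul_mul, this]
  have hτY : ∀ Z : Matrix B B ℂ, τ.trace * (Y * Z).trace = (Y * Z).trace := by
    intro Z
    by_cases h : D.trace = 0
    · rw [hYpos.trace_eq_zero_iff.1 (hYD.trans h)]; simp
    · rw [hτ, Matrix.trace_smul, smul_eq_mul, inv_mul_cancel₀ h, one_mul]
  refine ⟨(c : ℂ) • (Pt * X * Pt) + τ ⊗ₖ Y, ?_, ?_, ?_, ?_, ?_⟩
  · rw [traceRight_add, traceRight_smul, hPt, traceRight_conj, traceRight_kronecker, hYD, hτD, hD,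
      ← smul_add, mul_sub, sub_mul, add_sub_cancel]
  · rw [add_sub_cancel_left]
    exact hτpos.kronecker hYpos
  · rw [mul_add, add_mul, Matrix.mul_smul, Matrix.smul_mul]
    congr 1
    · congr 1
      have : Pt * Pt = Pt := by rw [hPt, ← mul_kronecker_mul, hPP, one_mul]
      rw [Matrix.mul_assoc, Matrix.mul_assoc _ Pt Pt, this, ← Matrix.mul_assoc, ← Matrix.mul_assoc,
        this]
    · rw [hPt, ← mul_kronecker_mul, ← mul_kronecker_mul, one_mul, mul_one, hPτ]
  · intro Z
    rw [add_mul, Matrix.trace_add, Matrix.smul_mul, Matrix.trace_smul, hPZ, ← mul_kronecker_mul,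
      trace_kronecker, mul_one, hτY, hYZ, smul_eq_mul]
    ring
  · refine ⟨fun a b a' b' => c * (P a a' * P b' b) + τ a b * (G * G) b' a', fun a z b w => ?_⟩
    have hYe : Y z w = ∑ a', ∑ b', (G * G) b' a' * X (a', z) (b', w) := by
      simp only [hY, hGt, traceLeft_apply, kronecker_one_conj_apply]
      rw [Finset.sum_comm]
      refine Finset.sum_congr rfl fun a' _ => ?_
      rw [Finset.sum_comm]
      refine Finset.sum_congr rfl fun b' _ => ?_
      rw [Matrix.mul_apply, Finset.sum_mul]
      exact Finset.sum_congr rfl fun e _ => by ring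
    rw [Matrix.add_apply, Matrix.smul_apply, kroneckerMap_apply, hYe, hPt,
      kronecker_one_conj_apply, smul_eq_mul, Finset.mul_sum, Finset.mul_sum, ← Finset.sum_add_distrib]
    refine Finset.sum_congr rfl fun a' _ => ?_
    rw [Finset.mul_sum, Finset.mul_sum, ← Finset.sum_add_distrib]
    exact Finset.sum_congr rfl fun b' _ => by ring

end PartialTrace

/-! ### Gentle measurement estimates -/

section Estimates

variable {I : Type*} [Fintype I] [DecidableEq I]

open scoped MatrixOrder in
theorem exists_eq_mul_conjTranspose {σ : Matrix I I ℂ} (hσ : σ.PosSemidef) :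
    ∃ C : Matrix I I ℂ, σ = C * Cᴴ := by
  obtain ⟨y, rfl⟩ := CStarAlgebra.nonneg_iff_eq_star_mul_self.mp hσ.nonneg
  exact ⟨yᴴ, by rw [conjTranspose_conjTranspose, star_eq_conjTranspose]⟩

theorem conjTranspose_mul_mul_apply (C O E : Matrix I I ℂ) (s : I) :
    (Cᴴ * O * E) s s = inner ℂ (WithLp.toLp 2 (C.col s))
      (toEuclideanCLM (n := I) (𝕜 := ℂ) O (WithLp.toLp 2 (E.col s))) := by
  rw [toEuclideanCLM_toLp, EuclideanSpace.inner_toLp_toLp, Matrix.mul_assoc]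
  simp only [Matrix.mul_apply, dotProduct, mulVec, conjTranspose_apply, Pi.star_apply, col_apply]
  exact Finset.sum_congr rfl fun i _ => mul_comm _ _

theorem conjTranspose_mul_self_apply (C : Matrix I I ℂ) (s : I) :
    (Cᴴ * C) s s = ((‖WithLp.toLp 2 (C.col s)‖ ^ 2 : ℝ) : ℂ) := by
  have h := conjTranspose_mul_mul_apply C 1 C s
  rw [mul_one] at h
  rw [h, map_one, one_apply_eq_self, inner_self_eq_norm_sq_to_K]
  norm_cast

theorem norm_inner_toEuclideanCLM_le (O : Matrix I I ℂ) {M : ℝ}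
    (hO : ‖toEuclideanCLM (n := I) (𝕜 := ℂ) O‖ ≤ M) (v w : EuclideanSpace ℂ I) :
    ‖inner ℂ v (toEuclideanCLM (n := I) (𝕜 := ℂ) O w)‖ ≤ M * (‖v‖ * ‖w‖) := by
  calc _ ≤ ‖v‖ * ‖toEuclideanCLM (n := I) (𝕜 := ℂ) O w‖ := norm_inner_le_norm _ _
    _ ≤ ‖v‖ * (M * ‖w‖) := by
        gcongr
        exact (ContinuousLinearMap.le_opNorm _ _).trans (by gcongr)
    _ = _ := by ring

theorem trace_re_mul_conjTranspose (C : Matrix I I ℂ) :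
    (C * Cᴴ).trace.re = ∑ s, ‖WithLp.toLp 2 (C.col s)‖ ^ 2 := by
  rw [Matrix.trace_mul_comm, Matrix.trace, Complex.re_sum]
  refine Finset.sum_congr rfl fun s _ => ?_
  rw [diag_apply, conjTranspose_mul_self_apply, Complex.ofReal_re]

theorem norm_trace_mul_le {σ : Matrix I I ℂ} (hσ : σ.PosSemidef) {O : Matrix I I ℂ} {M : ℝ}
    (hO : ‖toEuclideanCLM (n := I) (𝕜 := ℂ) O‖ ≤ M) :
    ‖(σ * O).trace‖ ≤ M * σ.trace.re := by
  obtain ⟨C, rfl⟩ := exists_eq_mul_conjTranspose hσ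
  rw [trace_re_mul_conjTranspose, Matrix.mul_assoc, Matrix.trace_mul_comm, Matrix.trace,
    Finset.mul_sum]
  refine (norm_sum_le _ _).trans (Finset.sum_le_sum fun s _ => ?_)
  rw [diag_apply, conjTranspose_mul_mul_apply, sq]
  exact norm_inner_toEuclideanCLM_le O hO _ _

/-- Gentle measurement. Writing `σ = C Cᴴ` reduces the claim to the columns `v` of `C`, each split
orthogonally as `v = p + q` with `p` in the range of `P`. The parameter `η` balances the small
weight of `q` against that of `v`, so the bounds for the columns simply add up; it is later set to
`√ε`. -/
theorem norm_trace_sub_trace_conj_le {σ : Matrix I I ℂ} (hσ : σ.PosSemidef) {P : Matrix I I ℂ}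
    (hP : P.IsHermitian) (hPP : P * P = P) {c : ℝ} (hc : c ≤ 1) {η : ℝ} (hη : 0 < η)
    {O : Matrix I I ℂ} {M : ℝ} (hO : ‖toEuclideanCLM (n := I) (𝕜 := ℂ) O‖ ≤ M) :
    ‖(σ * O).trace - c * (P * σ * P * O).trace‖ ≤
      M * (η⁻¹ * ((1 - P) * σ).trace.re + (η + (1 - c)) * σ.trace.re) := by
  obtain ⟨C, rfl⟩ := exists_eq_mul_conjTranspose hσ
  have hM : 0 ≤ M := (norm_nonneg _).trans hO
  have hQH : (1 - P)ᴴ = 1 - P := by rw [conjTranspose_sub, conjTranspose_one, hP.eq]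
  have hQQ : (1 - P) * (1 - P) = 1 - P := by
    rw [mul_sub, sub_mul, sub_mul, mul_one, one_mul, mul_one, hPP]; abel
  have hPQ : P * (1 - P) = 0 := by rw [mul_sub, mul_one, hPP, sub_self]
  have h1 : ((1 - P) * (C * Cᴴ)).trace = (((1 - P) * C) * ((1 - P) * C)ᴴ).trace := by
    rw [conjTranspose_mul, hQH, Matrix.mul_assoc, ← Matrix.mul_assoc C, Matrix.trace_mul_comm (1 - P),
      Matrix.trace_mul_comm (1 - P), Matrix.mul_assoc (C * Cᴴ), hQQ]
  have h2 : (P * (C * Cᴴ) * P * O).trace = ((P * C)ᴴ * O * (P * C)).trace := by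
    rw [conjTranspose_mul, hP.eq, Matrix.mul_assoc, Matrix.mul_assoc, Matrix.mul_assoc,
      ← Matrix.mul_assoc P, Matrix.trace_mul_comm]
    simp only [Matrix.mul_assoc]
  have h3 : (C * Cᴴ * O).trace = (Cᴴ * O * C).trace := by
    rw [Matrix.mul_assoc, Matrix.trace_mul_comm]
  rw [h1, h2, h3, trace_re_mul_conjTranspose, trace_re_mul_conjTranspose]
  simp only [Matrix.trace, Finset.mul_sum, ← Finset.sum_add_distrib, ← Finset.sum_sub_distrib,
    diag_apply]
  refine (norm_sum_le _ _).trans (Finset.sum_le_sum fun s _ => ?_)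
  rw [conjTranspose_mul_mul_apply, conjTranspose_mul_mul_apply]
  set v : EuclideanSpace ℂ I := WithLp.toLp 2 (C.col s) with hv
  set p : EuclideanSpace ℂ I := WithLp.toLp 2 ((P * C).col s) with hp
  set q : EuclideanSpace ℂ I := WithLp.toLp 2 (((1 - P) * C).col s) with hq
  have hvpq : v = p + q := by
    rw [hv, hp, hq, ← WithLp.toLp_add]
    congr 1
    ext i
    simp [sub_mul, col_apply]
  have hpq : inner ℂ p q = 0 := by
    have h := conjTranspose_mul_mul_apply (P * C) 1 ((1 - P) * C) s
    rw [map_one, one_apply_eq_self] at h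
    rw [hp, hq, ← h, mul_one, conjTranspose_mul, hP.eq, Matrix.mul_assoc, ← Matrix.mul_assoc P,
      hPQ]
    simp
  have hpv : ‖p‖ ≤ ‖v‖ := by
    have := norm_add_sq_eq_norm_sq_add_norm_sq_of_inner_eq_zero p q hpq
    rw [← hvpq] at this
    nlinarith [norm_nonneg p, norm_nonneg v, norm_nonneg q]
  have hdecomp : ∀ T : EuclideanSpace ℂ I →L[ℂ] EuclideanSpace ℂ I,
      inner ℂ v (T v) - c * inner ℂ p (T p) =
        inner ℂ q (T v) + inner ℂ p (T q) + ((1 - c : ℝ) : ℂ) * inner ℂ p (T p) := by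
    intro T
    rw [hvpq]
    simp only [map_add, inner_add_left, inner_add_right]
    push_cast
    ring
  rw [hdecomp]
  have e1 := norm_inner_toEuclideanCLM_le O hO q v
  have e2 := norm_inner_toEuclideanCLM_le O hO p q
  have e3 := norm_inner_toEuclideanCLM_le O hO p p
  have e4 : ‖((1 - c : ℝ) : ℂ)‖ = 1 - c := by
    rw [Complex.norm_real, Real.norm_of_nonneg (by linarith)]
  -- Weighted AM-GM, from the square of `‖q‖ - η ‖v‖`.
  have e5 : 2 * (‖q‖ * ‖v‖) ≤ η⁻¹ * ‖q‖ ^ 2 + η * ‖v‖ ^ 2 := by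
    have h : 0 ≤ η⁻¹ * (‖q‖ - η * ‖v‖) ^ 2 := by positivity
    have h' : η⁻¹ * (‖q‖ - η * ‖v‖) ^ 2 = η⁻¹ * ‖q‖ ^ 2 + η * ‖v‖ ^ 2 - 2 * (‖q‖ * ‖v‖) := by
      field_simp
      ring
    linarith
  have e6 : ‖p‖ * ‖q‖ ≤ ‖q‖ * ‖v‖ := by
    rw [mul_comm]; gcongr
  have e7 : ‖p‖ * ‖p‖ ≤ ‖v‖ ^ 2 := by rw [sq]; gcongr
  calc _ ≤ ‖inner ℂ q (toEuclideanCLM (n := I) (𝕜 := ℂ) O v)‖ +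
        ‖inner ℂ p (toEuclideanCLM (n := I) (𝕜 := ℂ) O q)‖ +
        (1 - c) * ‖inner ℂ p (toEuclideanCLM (n := I) (𝕜 := ℂ) O p)‖ := by
        refine (norm_add_le _ _).trans (add_le_add (norm_add_le _ _) ?_)
        rw [norm_mul, e4]
    _ ≤ M * (‖q‖ * ‖v‖) + M * (‖q‖ * ‖v‖) + (1 - c) * (M * ‖v‖ ^ 2) := by
        refine add_le_add (add_le_add e1 (e2.trans ?_)) ?_
        · gcongr
        · refine mul_le_mul_of_nonneg_left (e3.trans ?_) (by linarith)
          gcongr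
    _ = M * (2 * (‖q‖ * ‖v‖) + (1 - c) * ‖v‖ ^ 2) := by ring
    _ ≤ M * (η⁻¹ * ‖q‖ ^ 2 + η * ‖v‖ ^ 2 + (1 - c) * ‖v‖ ^ 2) := by gcongr
    _ = _ := by ring

end Estimates

/-! ### Low-rank spectral projections from Rényi entropies -/

section SpectralTruncation

/-- Discarding the entries of a probability vector below a suitable threshold costs at most `ε` and
leaves a number of entries controlled by its Rényi entropy of order `α`. -/
theorem exists_finset_card_le_of_renyi {A : Type*} [Fintype A] {p : A → ℝ} (hp : ∀ i, 0 ≤ p i)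
    (hsum : ∑ i, p i = 1) {α R ε : ℝ} (hα0 : 0 < α) (hα1 : α < 1)
    (hR : (1 - α)⁻¹ * Real.log (∑ i, p i ^ α) ≤ R) (hε : 0 < ε) :
    ∃ T : Finset A, (T.card : ℝ) ≤ Real.exp R * (1 / ε) ^ (α / (1 - α)) ∧
      1 - ε ≤ ∑ i ∈ T, p i := by
  classical
  have h1α : 0 < 1 - α := by linarith
  set S : ℝ := ∑ i, p i ^ α with hS
  have hSpos : 0 < S := by
    obtain ⟨i, -, hi⟩ : ∃ i ∈ Finset.univ, 0 < p i := by
      by_contra! h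
      have : ∑ i, p i ≤ 0 := Finset.sum_nonpos h
      linarith
    exact (Real.rpow_pos_of_pos hi α).trans_le
      (Finset.single_le_sum (f := fun i => p i ^ α) (fun i _ => Real.rpow_nonneg (hp i) α)
        (Finset.mem_univ i))
  have hSR : S ^ (1 - α)⁻¹ ≤ Real.exp R := by
    rw [Real.rpow_def_of_pos hSpos, mul_comm]
    exact Real.exp_le_exp.2 hR
  -- The threshold solves `θ ^ (1 - α) * S = ε`: entries at most `θ` satisfy `p i ≤ θ ^ (1 - α) * p
  -- i ^ α` and so sum to at most `ε`, while each larger one contributes at least `θ ^ α` to `S`.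
  set θ : ℝ := (ε / S) ^ (1 - α)⁻¹ with hθ
  have hθpos : 0 < θ := Real.rpow_pos_of_pos (div_pos hε hSpos) _
  have hθ1 : θ ^ (1 - α) = ε / S := by
    rw [hθ, ← Real.rpow_mul (div_pos hε hSpos).le, inv_mul_cancel₀ h1α.ne', Real.rpow_one]
  refine ⟨Finset.univ.filter fun i => θ < p i, ?_, ?_⟩
  · have h1 : ((Finset.univ.filter fun i => θ < p i).card : ℝ) * θ ^ α ≤ S := by
      rw [← nsmul_eq_mul, ← Finset.sum_const]
      refine (Finset.sum_le_sum (f := fun _ => θ ^ α) (g := fun i => p i ^ α)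
        fun i hi => ?_).trans (Finset.sum_le_univ_sum_of_nonneg
          fun i => Real.rpow_nonneg (hp i) α)
      exact Real.rpow_le_rpow hθpos.le (Finset.mem_filter.1 hi).2.le hα0.le
    have h2 : S / θ ^ α = S ^ (1 - α)⁻¹ * (1 / ε) ^ (α / (1 - α)) := by
      have e : θ ^ α = ε ^ (α / (1 - α)) / S ^ (α / (1 - α)) := by
        rw [hθ, ← Real.rpow_mul (div_pos hε hSpos).le, Real.div_rpow hε.le hSpos.le]
        congr 2 <;> field_simp
      have e2 : S ^ (1 - α)⁻¹ = S * S ^ (α / (1 - α)) := by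
        conv_rhs => rw [← Real.rpow_one_add' hSpos.le (by positivity)]
        congr 1
        field_simp
        ring
      rw [e, e2, Real.div_rpow zero_le_one hε.le, Real.one_rpow]
      field_simp
    calc _ ≤ S / θ ^ α := by rwa [le_div_iff₀ (Real.rpow_pos_of_pos hθpos α)]
      _ ≤ _ := by rw [h2]; gcongr
  · have h1 : ∑ i ∈ Finset.univ.filter (fun i => ¬ θ < p i), p i ≤ ε := by
      calc ∑ i ∈ Finset.univ.filter (fun i => ¬ θ < p i), p i
          ≤ ∑ i ∈ Finset.univ.filter (fun i => ¬ θ < p i), θ ^ (1 - α) * p i ^ α := by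
            refine Finset.sum_le_sum fun i hi => ?_
            have hle : p i ≤ θ := not_lt.1 (Finset.mem_filter.1 hi).2
            calc p i = p i ^ (1 - α) * p i ^ α := by
                  rw [← Real.rpow_add' (hp i) (by simp)]; simp
              _ ≤ _ := by
                  have := hp i
                  gcongr
        _ ≤ ∑ i, θ ^ (1 - α) * p i ^ α :=
            Finset.sum_le_univ_sum_of_nonneg fun i =>
              mul_nonneg (Real.rpow_nonneg hθpos.le _) (Real.rpow_nonneg (hp i) α)
        _ = ε := by rw [← Finset.mul_sum, hθ1, ← hS, div_mul_cancel₀ _ hSpos.ne']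
    have h2 := Finset.sum_filter_add_sum_filter_not Finset.univ (fun i => θ < p i) p
    linarith

variable {A : Type*} [Fintype A] [DecidableEq A]

/-- `P` is an orthogonal projection that captures the density matrix `Λ` up to weight `ε`, and `c`
rescales the truncation `P Λ P` to weight `1 - ε`. -/
structure IsFilter (Λ : Matrix A A ℂ) (ε : ℝ) (P : Matrix A A ℂ) (c : ℝ) : Prop where
  isHermitian : P.IsHermitian
  mul_self : P * P = P
  nonneg : 0 ≤ c
  le_one : c ≤ 1
  one_sub_le : 1 - ε ≤ c
  trace_eq : (c : ℂ) * (P * Λ).trace = ((1 - ε : ℝ) : ℂ)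
  trace_compl_le : ((1 - P) * Λ).trace.re ≤ ε
  posSemidef_sub : (Λ - (c : ℂ) • (P * Λ * P)).PosSemidef

/-- Serves the ends of the chain, where no rank has to be reduced. The factor `1 - ε` gives the
state the same trace as every other filter does. -/
theorem isFilter_one {Λ : Matrix A A ℂ} (hΛ : Λ.PosSemidef) (htr : Λ.trace = 1) {ε : ℝ}
    (hε : 0 < ε) (hε1 : ε < 1) : IsFilter Λ ε 1 (1 - ε) where
  isHermitian := isHermitian_one
  mul_self := one_mul 1
  nonneg := by linarith
  le_one := by linarith
  one_sub_le := le_rfl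
  trace_eq := by rw [one_mul, htr, mul_one]
  trace_compl_le := by simpa using hε.le
  posSemidef_sub := by
    have h : Λ - ((1 - ε : ℝ) : ℂ) • (1 * Λ * 1) = (ε : ℂ) • Λ := by
      rw [one_mul, mul_one]; push_cast; module
    rw [h]
    exact hΛ.smul (by exact_mod_cast hε.le)

theorem exists_isFilter {Λ : Matrix A A ℂ} (hΛ : Λ.PosSemidef) (htr : Λ.trace = 1)
    {α R ε : ℝ} (hα0 : 0 < α) (hα1 : α < 1)
    (hR : (1 - α)⁻¹ * Real.log (∑ i, hΛ.isHermitian.eigenvalues i ^ α) ≤ R) (hε : 0 < ε)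
    (hε1 : ε < 1) :
    ∃ (P : Matrix A A ℂ) (c : ℝ), IsFilter Λ ε P c ∧ ∃ D : ℕ, 0 < D ∧
      (D : ℝ) ≤ Real.exp R * (1 / ε) ^ (α / (1 - α)) ∧
      ∃ W : Matrix A (Fin D) ℂ, P = W * Wᴴ := by
  set p := hΛ.isHermitian.eigenvalues with hp
  have hp0 : ∀ i, 0 ≤ p i := hΛ.eigenvalues_nonneg
  have hsum : ∑ i, p i = 1 := by
    have := hΛ.isHermitian.trace_eq_sum_eigenvalues
    rw [htr] at this
    simpa [hp] using (congrArg Complex.re this).symm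
  obtain ⟨T, hTcard, hT⟩ := exists_finset_card_le_of_renyi hp0 hsum hα0 hα1 hR hε
  set E : Matrix A A ℂ := (hΛ.isHermitian.eigenvectorUnitary : Matrix A A ℂ) with hE
  have hEE : Eᴴ * E = 1 := Unitary.coe_star_mul_self hΛ.isHermitian.eigenvectorUnitary
  have hspec : Λ = E * diagonal (fun i => (p i : ℂ)) * Eᴴ := hΛ.isHermitian.spectral_theorem
  have hmul : ∀ f g : A → ℂ, E * diagonal f * Eᴴ * (E * diagonal g * Eᴴ) =
      E * diagonal (fun i => f i * g i) * Eᴴ := by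
    intro f g
    calc _ = E * diagonal f * (Eᴴ * E) * diagonal g * Eᴴ := by simp only [Matrix.mul_assoc]
      _ = _ := by rw [hEE, mul_one, Matrix.mul_assoc E, diagonal_mul_diagonal]
  have htrace : ∀ f : A → ℂ, (E * diagonal f * Eᴴ).trace = ∑ i, f i := by
    intro f
    rw [Matrix.trace_mul_comm, ← Matrix.mul_assoc, hEE, one_mul, trace_diagonal]
  have hpsd : ∀ f : A → ℝ, (∀ i, 0 ≤ f i) →
      (E * diagonal (fun i => (f i : ℂ)) * Eᴴ).PosSemidef := by
    intro f hf
    refine PosSemidef.mul_mul_conjTranspose_same (PosSemidef.diagonal fun i => ?_) E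
    simpa using hf i
  set χ : A → ℝ := fun i => if i ∈ T then 1 else 0 with hχ
  have hχχ : ∀ i, χ i * χ i = χ i := by intro i; simp [hχ]
  have hχ0 : ∀ i, 0 ≤ χ i := by intro i; simp only [hχ]; split_ifs <;> norm_num
  have hχ1 : ∀ i, χ i ≤ 1 := by intro i; simp only [hχ]; split_ifs <;> norm_num
  set P : Matrix A A ℂ := E * diagonal (fun i => (χ i : ℂ)) * Eᴴ with hP
  set w : ℝ := ∑ i ∈ T, p i with hw
  have hwχ : ∑ i, χ i * p i = w := by simp [hχ, hw]
  have hwpos : 0 < w := by linarith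
  have hw1 : w ≤ 1 := by
    rw [← hsum, hw]
    exact Finset.sum_le_univ_sum_of_nonneg hp0
  have hPΛ : P * Λ = E * diagonal (fun i => ((χ i * p i : ℝ) : ℂ)) * Eᴴ := by
    rw [hP]; conv_lhs => rw [hspec]
    rw [hmul]; push_cast; rfl
  have hPΛP : P * Λ * P = E * diagonal (fun i => ((χ i * p i : ℝ) : ℂ)) * Eᴴ := by
    rw [hPΛ, hP, hmul]
    congr 3
    ext i
    rw [← Complex.ofReal_mul, mul_right_comm, hχχ]
  have htrP : (P * Λ).trace = (w : ℂ) := by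
    rw [hPΛ, htrace, ← hwχ]; push_cast; rfl
  have hcle : (1 - ε) / w ≤ 1 := by rw [div_le_one hwpos]; exact hT
  -- The kept weight `w` varies from cut to cut but is at least `1 - ε`. Rescaling by `(1 - ε) / w ≤
  -- 1` equalizes the traces, as a truncation with unchanged right marginal requires, and keeps `c P
  -- Λ P` below `Λ`.
  refine ⟨P, (1 - ε) / w, ⟨?_, ?_, ?_, hcle, ?_, ?_, ?_, ?_⟩, T.card, ?_, hTcard,
    E.submatrix id (fun i => (T.equivFin.symm i : A)), ?_⟩
  · exact (hpsd χ hχ0).isHermitian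
  · rw [hP, hmul]
    congr 3
    ext i
    rw [← Complex.ofReal_mul, hχχ]
  · exact div_nonneg (by linarith) hwpos.le
  · rw [le_div_iff₀ hwpos]
    nlinarith
  · rw [htrP, ← Complex.ofReal_mul, div_mul_cancel₀ _ hwpos.ne']
  · rw [sub_mul, one_mul, Matrix.trace_sub, htr, htrP, Complex.sub_re, Complex.one_re,
      Complex.ofReal_re]
    linarith
  · have h : Λ - (((1 - ε) / w : ℝ) : ℂ) • (P * Λ * P) =
        E * diagonal (fun i => ((p i - (1 - ε) / w * (χ i * p i) : ℝ) : ℂ)) * Eᴴ := by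
      rw [hPΛP]
      conv_lhs => rw [hspec]
      rw [← Matrix.smul_mul, ← Matrix.mul_smul, ← sub_mul, ← mul_sub, ← diagonal_smul,
        diagonal_sub]
      congr 3
      ext i
      simp
    rw [h]
    refine hpsd _ fun i => ?_
    have h0 : 0 ≤ (1 - ε) / w := div_nonneg (by linarith) hwpos.le
    have h1 : (1 - ε) / w * χ i ≤ 1 := mul_le_one₀ hcle (hχ0 i) (hχ1 i)
    nlinarith [hp0 i]
  · rw [Finset.card_pos]
    by_contra h
    rw [Finset.not_nonempty_iff_eq_empty] at h
    rw [hw, h, Finset.sum_empty] at hwpos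
    exact lt_irrefl _ hwpos
  · ext a b
    rw [hP, Matrix.mul_apply, Matrix.mul_apply]
    simp only [mul_diagonal, conjTranspose_apply, submatrix_apply, id]
    rw [T.equivFin.symm.sum_comp (fun i : T => E a i * star (E b i)), Finset.sum_coe_sort T
      (fun i => E a i * star (E b i))]
    have h : ∀ i, ((χ i : ℝ) : ℂ) = if i ∈ T then 1 else 0 := by
      intro i; simp only [hχ]; split_ifs <;> simp
    simp [h]

end SpectralTruncation

/-! ### Rank factorization -/

section RankFactorization

variable {I J : Type*} [Fintype J]

/-- A matrix that factors through `r` dimensions factors through `r` of its column combinations. -/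
theorem exists_factorization_through_range {M : Matrix I J ℂ} {r : ℕ}
    (h : ∃ (F : Matrix I (Fin r) ℂ) (G : Matrix (Fin r) J ℂ), M = F * G) :
    ∃ (g : Matrix J (Fin r) ℂ) (G : Matrix (Fin r) J ℂ), M = M * g * G := by
  classical
  obtain ⟨F, G, hM⟩ := h
  have hrank : M.rank ≤ r := by
    rw [hM]
    exact (Matrix.rank_mul_le_left F G).trans ((Matrix.rank_le_card_width F).trans (by simp))
  set V := LinearMap.range M.mulVecLin
  have hV : Module.finrank ℂ V = M.rank := rfl
  let b := Module.finBasis ℂ V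
  have hb : ∀ i, ∃ v : J → ℂ, M *ᵥ v = (b i : I → ℂ) := fun i => (b i).2
  choose v hv using hb
  have hlt : ∀ i : Fin (Module.finrank ℂ V), i.val < r := fun i => i.2.trans_le (hV.le.trans hrank)
  let col : J → V := fun j => ⟨M.col j, ⟨Pi.single j 1, by simp⟩⟩
  -- A basis of the column space, padded by zeros to length `r`: `g` holds preimages of the basis
  -- vectors and `G` the coordinates of the columns.
  refine ⟨Matrix.of fun j k => if hk : k.val < Module.finrank ℂ V then v ⟨k, hk⟩ j else 0,
    Matrix.of fun k j => if hk : k.val < Module.finrank ℂ V then b.repr (col j) ⟨k, hk⟩ else 0, ?_⟩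
  ext i j
  have h1 : M i j = ∑ k, b.repr (col j) k * (b k : I → ℂ) i := by
    have := congrArg (fun x : V => (x : I → ℂ) i) (b.sum_repr (col j))
    simp only [Submodule.coe_sum, Submodule.coe_smul, Finset.sum_apply, Pi.smul_apply,
      smul_eq_mul] at this
    exact this.symm
  rw [h1, Matrix.mul_apply]
  refine Finset.sum_of_injOn (fun k => ⟨k.val, hlt k⟩) ?_ (by simp) ?_ ?_
  · intro k _ k' _ hkk
    exact Fin.ext (by simpa using hkk)
  · intro k _ hk
    have : ¬ k.val < Module.finrank ℂ V := fun h => hk ⟨⟨k, h⟩, by simp, by simp⟩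
    simp [this]
  · intro k _
    simp only [Matrix.mul_apply, of_apply, k.2, dite_true]
    rw [← hv k, mul_comm]
    rfl

end RankFactorization

/-! ### Operators of bounded Schmidt rank are MPOs -/

section SchmidtRank

variable {n d : ℕ}

/-- The configuration that agrees with `x` on the first `k` spins and with `z` on the others. -/
def merge (k : ℕ) (x z : Config n d) : Config n d := fun i => if i.val < k then x i else z i

theorem merge_zero (x z : Config n d) : merge 0 x z = z := by
  funext i; simp [merge]

theorem merge_of_le {k : ℕ} (hk : n ≤ k) (x z : Config n d) : merge k x z = x := by
  funext i; simp [merge, i.2.trans_le hk]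

theorem merge_succ {k : ℕ} (hk : k < n) (x z : Config n d) :
    merge (k + 1) x z = merge k x (Function.update z ⟨k, hk⟩ (x ⟨k, hk⟩)) := by
  funext i
  simp only [merge, Function.update_apply, Fin.ext_iff]
  split_ifs with h1 h2 h3 h4 <;> first | rfl | (exfalso; omega) | skip
  obtain rfl : i = ⟨k, hk⟩ := Fin.ext h3
  rfl

/-- The operator Schmidt rank of `X` across the cut after the first `k` spins is at most `r`. -/
def SchmidtRankLE (k r : ℕ) (X : Op n d) : Prop :=
  ∃ F G : Fin r → Config n d → Config n d → ℂ, ∀ x y z w,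
    X (merge k x z) (merge k y w) = ∑ β, F β x y * G β z w

/-- The entries of `X` as a matrix from the right half of the chain to the left half. -/
def cutOp (k : ℕ) (X : Op n d) : Matrix (Config n d × Config n d) (Config n d × Config n d) ℂ :=
  Matrix.of fun p q => X (merge k p.1 q.1) (merge k p.2 q.2)

/-- Moving the cut past one spin only relabels columns. Hence left factors that are combinations of
columns at cut `k + 1` can be computed from those at cut `k`, which is the MPO recursion. -/
theorem cutOp_succ {k : ℕ} (hk : k < n) (X : Op n d) (p q : Config n d × Config n d) :
    cutOp (k + 1) X p q = cutOp k X p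
      (Function.update q.1 ⟨k, hk⟩ (p.1 ⟨k, hk⟩), Function.update q.2 ⟨k, hk⟩ (p.2 ⟨k, hk⟩)) := by
  simp [cutOp, merge_succ hk]

/-- Factorizations of the cut matrices of `X`, normalized at both ends of the chain, in which the
left factors are combinations of columns of the cut matrices. -/
theorem exists_cutOp_factorization [Nonempty (Config n d)] (hn : 0 < n) (X : Op n d) (r : ℕ → ℕ)
    (hr : ∀ k, 0 < r k) (hX : ∀ k, 0 < k → k < n → SchmidtRankLE k (r k) X) (k : ℕ) :
    ∃ (F g : Matrix (Config n d × Config n d) (Fin (r k)) ℂ)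
      (G : Matrix (Fin (r k)) (Config n d × Config n d) ℂ),
      (0 < k → F = cutOp k X * g) ∧ (k < n → cutOp k X = F * G) ∧
      (k = 0 → ∀ p, F p ⟨0, hr k⟩ = 1) ∧ (k = n → ∀ p, F p ⟨0, hr k⟩ = X p.1 p.2) := by
  rcases Nat.eq_zero_or_pos k with rfl | hk
  · refine ⟨Matrix.of fun _ β => if β = ⟨0, hr 0⟩ then 1 else 0, 0,
      Matrix.of fun _ q => X q.1 q.2, fun h => absurd h (lt_irrefl _), fun _ => ?_, fun _ p => by simp,
      fun h => absurd h hn.ne⟩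
    ext p q
    simp [cutOp, merge_zero, Matrix.mul_apply]
  · rcases lt_or_ge k n with hkn | hkn
    · obtain ⟨F, G, hFG⟩ := hX k hk hkn
      obtain ⟨g, G', h⟩ := exists_factorization_through_range (M := cutOp k X) (r := r k)
        ⟨Matrix.of fun p β => F β p.1 p.2, Matrix.of fun β q => G β q.1 q.2, by
          ext p q; simp [cutOp, hFG, Matrix.mul_apply]⟩
      exact ⟨cutOp k X * g, g, G', fun _ => rfl, fun _ => h, fun h => absurd h hk.ne',
        fun h => absurd h hkn.ne⟩
    · let q₀ : Config n d × Config n d := Classical.arbitrary _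
      refine ⟨cutOp k X * Matrix.of fun q _ => if q = q₀ then 1 else 0,
        Matrix.of fun q _ => if q = q₀ then 1 else 0, 0, fun _ => rfl,
        fun h => absurd h hkn.not_gt, fun h => absurd h hk.ne', fun _ p => ?_⟩
      simp [cutOp, merge_of_le hkn, Matrix.mul_apply]

/-- An operator whose Schmidt rank across every cut is bounded is an MPO with these bounds as
bond dimensions. -/
theorem exists_MPO_of_schmidtRankLE [Nonempty (Config n d)] (hn : 0 < n) (X : Op n d) (r : ℕ → ℕ)
    (hr : ∀ k, 0 < r k) (hr0 : r 0 = 1) (hrn : r n = 1)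
    (hX : ∀ k, 0 < k → k < n → SchmidtRankLE k (r k) X) :
    ∃ K : MPO n d, K.bond = r ∧ K.toOp = X := by
  choose F g G hFg hFG hF0 hFn using exists_cutOp_factorization hn X r hr hX
  let K : MPO n d :=
    { bond := r
      bond_pos := fun k _ => hr k
      bond_zero := hr0
      bond_last := hrn
      tensor := fun k i j => Matrix.of fun β β' =>
        ∑ q : Config n d × Config n d,
          G k β (Function.update q.1 k i, Function.update q.2 k j) * g (k + 1) q β' }
  have hK : ∀ (x y : Config n d) (m : ℕ) (hm : m ≤ n) (β : Fin (r m)),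
      K.leftProd x y m hm ⟨0, hr 0⟩ β = F m (x, y) β := by
    intro x y m
    induction m with
    | zero =>
      intro _ β
      have hβ : β = ⟨0, hr 0⟩ := Fin.ext (by have := β.2; omega)
      rw [hβ, hF0 0 rfl]
      exact Matrix.one_apply_eq _
    | succ m ih =>
      intro hm β'
      have e : K.leftProd x y (m + 1) hm ⟨0, hr 0⟩ β' =
          ∑ β, K.leftProd x y m (Nat.le_of_succ_le hm) ⟨0, hr 0⟩ β *
            K.tensor ⟨m, hm⟩ (x ⟨m, hm⟩) (y ⟨m, hm⟩) β β' := rfl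
      rw [e, hFg (m + 1) m.succ_pos, Matrix.mul_apply]
      simp only [ih]
      simp only [K, of_apply, Finset.mul_sum]
      rw [Finset.sum_comm]
      refine Finset.sum_congr rfl fun q _ => ?_
      rw [cutOp_succ hm, hFG m hm, Matrix.mul_apply, Finset.sum_mul]
      exact Finset.sum_congr rfl fun β _ => (mul_assoc _ _ _).symm
  refine ⟨K, rfl, ?_⟩
  ext x y
  exact (hK x y n le_rfl ⟨0, hr n⟩).trans (hFn n rfl (x, y))

end SchmidtRank

/-! ### Cutting the chain: marginals, local operators, Schmidt ranks -/

section Cuts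

variable {n d : ℕ}

/-- Configurations of the first `k` spins. -/
abbrev LeftConfig (n d k : ℕ) : Type := {i : Fin n // i.val < k} → Fin d

/-- Configurations of all but the first `k` spins. -/
abbrev RightConfig (n d k : ℕ) : Type := {i : Fin n // ¬ i.val < k} → Fin d

/-- Cutting a configuration after the first `k` spins. -/
def cutEquiv (n d k : ℕ) : Config n d ≃ LeftConfig n d k × RightConfig n d k :=
  Equiv.piEquivPiSubtypeProd (fun i : Fin n => i.val < k) (fun _ => Fin d)

/-- An operator on the chain as an operator on a bipartite system. -/
def split (k : ℕ) (X : Op n d) :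
    Matrix (LeftConfig n d k × RightConfig n d k) (LeftConfig n d k × RightConfig n d k) ℂ :=
  X.submatrix (cutEquiv n d k).symm (cutEquiv n d k).symm

/-- An operator on a bipartite system as an operator on the chain. -/
def unsplit (k : ℕ)
    (X : Matrix (LeftConfig n d k × RightConfig n d k) (LeftConfig n d k × RightConfig n d k) ℂ) :
    Op n d :=
  X.submatrix (cutEquiv n d k) (cutEquiv n d k)

theorem split_unsplit (k : ℕ)
    (X : Matrix (LeftConfig n d k × RightConfig n d k) (LeftConfig n d k × RightConfig n d k) ℂ) :
    split k (unsplit k X) = X := by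
  ext p q; simp [split, unsplit]

theorem split_mul (k : ℕ) (X Y : Op n d) : split k (X * Y) = split k X * split k Y :=
  (Matrix.submatrix_mul_equiv X Y _ _ _).symm

theorem split_sub (k : ℕ) (X Y : Op n d) : split k (X - Y) = split k X - split k Y := rfl

theorem split_smul (k : ℕ) (c : ℂ) (X : Op n d) : split k (c • X) = c • split k X := rfl

theorem split_one (k : ℕ) : split k (1 : Op n d) = 1 :=
  Matrix.submatrix_one_equiv _

theorem trace_split (k : ℕ) (X : Op n d) : (split k X).trace = X.trace :=
  (cutEquiv n d k).symm.sum_comp fun x => X x x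

theorem split_injective (k : ℕ) : Function.Injective (split k : Op n d → _) := by
  intro X Y h
  ext x y
  have := congrFun (congrFun h (cutEquiv n d k x)) (cutEquiv n d k y)
  simpa [split] using this

theorem posSemidef_split_iff (k : ℕ) {X : Op n d} : (split k X).PosSemidef ↔ X.PosSemidef :=
  Matrix.posSemidef_submatrix_equiv _

/-- The operator that acts as `P` on the first `k` spins. -/
def leftOp (k : ℕ) (P : Matrix (LeftConfig n d k) (LeftConfig n d k) ℂ) : Op n d :=
  unsplit k (P ⊗ₖ (1 : Matrix (RightConfig n d k) (RightConfig n d k) ℂ))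

theorem split_leftOp (k : ℕ) (P : Matrix (LeftConfig n d k) (LeftConfig n d k) ℂ) :
    split k (leftOp k P) = P ⊗ₖ (1 : Matrix (RightConfig n d k) (RightConfig n d k) ℂ) :=
  split_unsplit k _

theorem leftOp_mul_self {k : ℕ} {P : Matrix (LeftConfig n d k) (LeftConfig n d k) ℂ}
    (hP : P * P = P) : leftOp k P * leftOp k P = leftOp k P := by
  apply split_injective k
  rw [split_mul, split_leftOp, ← mul_kronecker_mul, hP, one_mul]

theorem leftOp_isHermitian {k : ℕ} {P : Matrix (LeftConfig n d k) (LeftConfig n d k) ℂ}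
    (hP : P.IsHermitian) : (leftOp k P).IsHermitian := by
  refine IsHermitian.submatrix ?_ _
  unfold IsHermitian
  rw [conjTranspose_kronecker, hP.eq, conjTranspose_one]

theorem trace_one_sub_leftOp_mul (k : ℕ) (P : Matrix (LeftConfig n d k) (LeftConfig n d k) ℂ)
    (X : Op n d) :
    ((1 - leftOp k P) * X).trace = ((1 - P) * traceRight (split k X)).trace := by
  rw [← trace_split k, split_mul, split_sub, split_one, split_leftOp, Matrix.trace_mul_comm, mul_sub,
    mul_one, Matrix.trace_sub, trace_mul_kronecker_one, sub_mul, one_mul, Matrix.trace_sub,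
    trace_traceRight, Matrix.trace_mul_comm P]

/-- The density matrix `|ψ⟩⟨ψ|`. -/
def density (ψ : State n d) : Op n d := Matrix.vecMulVec ψ (star ψ)

theorem posSemidef_density (ψ : State n d) : (density ψ).PosSemidef :=
  Matrix.posSemidef_vecMulVec_self_star _

theorem expect_eq_trace (ψ : State n d) (O : Op n d) : expect ψ O = (density ψ * O).trace := by
  rw [expect, density, Matrix.trace_mul_comm, Matrix.mul_vecMulVec, Matrix.trace_vecMulVec]
  rfl

theorem trace_density {ψ : State n d} (hψ : ‖ψ‖ = 1) : (density ψ).trace = 1 := by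
  have h := expect_eq_trace ψ 1
  rw [mul_one] at h
  rw [← h, expect, map_one, one_apply_eq_self, inner_self_eq_norm_sq_to_K, hψ]
  simp

theorem reducedDensity_eq_traceRight (ψ : State n d) (k : ℕ) :
    reducedDensity ψ k = traceRight (split k (density ψ)) := rfl

theorem posSemidef_reducedDensity (ψ : State n d) (k : ℕ) : (reducedDensity ψ k).PosSemidef :=
  Matrix.posSemidef_self_mul_conjTranspose _

theorem trace_reducedDensity {ψ : State n d} (hψ : ‖ψ‖ = 1) (k : ℕ) :
    (reducedDensity ψ k).trace = 1 := by
  rw [reducedDensity_eq_traceRight, trace_traceRight, trace_split, trace_density hψ]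

/-- The first spin to the right of a cut can be split off. -/
def rightConfigSuccEquiv {k : ℕ} (hk : k < n) :
    RightConfig n d k ≃ Fin d × RightConfig n d (k + 1) where
  toFun z := (z ⟨⟨k, hk⟩, lt_irrefl k⟩, fun j => z ⟨j.1, fun h => j.2 (h.trans k.lt_succ_self)⟩)
  invFun p := fun j => if h : j.1.val < k + 1 then p.1 else p.2 ⟨j.1, h⟩
  left_inv z := by
    funext j
    by_cases h : j.1.val < k + 1
    · have hj : j = ⟨⟨k, hk⟩, lt_irrefl k⟩ := by
        apply Subtype.ext; apply Fin.ext
        have := j.2; simp only; omega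
      simp only [h, dite_true]
      rw [hj]
    · simp only [h, dite_false]
  right_inv p := by
    refine Prod.ext ?_ (funext fun j => ?_)
    · simp
    · simp only [j.2, dite_false]

/-- Appending the spin `i` to a configuration of the first `k` spins. -/
def leftConfigSnoc {k : ℕ} (i : Fin d) (a : LeftConfig n d k) : LeftConfig n d (k + 1) :=
  fun j => if h : j.1.val < k then a ⟨j.1, h⟩ else i

theorem cutEquiv_symm_leftConfigSnoc {k : ℕ} (hk : k < n) (a : LeftConfig n d k)
    (z : RightConfig n d k) :
    (cutEquiv n d (k + 1)).symm (leftConfigSnoc (rightConfigSuccEquiv hk z).1 a,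
      (rightConfigSuccEquiv hk z).2) = (cutEquiv n d k).symm (a, z) := by
  funext j
  simp only [cutEquiv, Equiv.piEquivPiSubtypeProd_symm_apply, leftConfigSnoc, rightConfigSuccEquiv,
    Equiv.coe_fn_mk]
  by_cases h : j.val < k
  · simp [h, h.trans k.lt_succ_self]
  · by_cases h' : j.val < k + 1
    · have hj : j = ⟨k, hk⟩ := Fin.ext (by simp only; omega)
      subst hj
      simp
    · simp [h, h']

theorem traceRight_split_eq_sum {k : ℕ} (hk : k < n) (X : Op n d) :
    traceRight (split k X) =
      ∑ i, (traceRight (split (k + 1) X)).submatrix (leftConfigSnoc i) (leftConfigSnoc i) := by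
  ext a b
  simp only [Matrix.sum_apply, submatrix_apply, traceRight_apply]
  rw [← Fintype.sum_prod_type', ← (rightConfigSuccEquiv hk).sum_comp]
  refine Finset.sum_congr rfl fun z _ => ?_
  simp only [split, submatrix_apply, cutEquiv_symm_leftConfigSnoc]

/-- Applied to a difference of operators, this carries domination of marginals from one cut to the
next on its left. -/
theorem posSemidef_traceRight_split_of_succ {k : ℕ} (hk : k < n) {X : Op n d}
    (hX : (traceRight (split (k + 1) X)).PosSemidef) : (traceRight (split k X)).PosSemidef := by
  rw [traceRight_split_eq_sum hk]
  exact Matrix.posSemidef_sum _ fun i _ => hX.submatrix _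

theorem ActsOn.exists_split_eq_kronecker_one {S : Finset (Fin n)} {O : Op n d} (hO : ActsOn S O)
    {k : ℕ} (hS : ∀ i ∈ S, i.val < k) :
    ∃ Y : Matrix (LeftConfig n d k) (LeftConfig n d k) ℂ,
      split k O = Y ⊗ₖ (1 : Matrix (RightConfig n d k) (RightConfig n d k) ℂ) := by
  obtain ⟨P, hP⟩ := hO
  refine ⟨Matrix.of fun a b => if ∀ i, i.1 ∉ S → a i = b i then
    P (fun i => a ⟨i, hS i i.2⟩) (fun i => b ⟨i, hS i i.2⟩) else 0, ?_⟩
  ext ⟨a, z⟩ ⟨b, w⟩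
  rw [split, submatrix_apply, hP, kroneckerMap_apply, of_apply, Matrix.one_apply, mul_ite, mul_one,
    mul_zero, ← ite_and]
  have hiff : (∀ i, i ∉ S → (cutEquiv n d k).symm (a, z) i = (cutEquiv n d k).symm (b, w) i) ↔
      z = w ∧ ∀ i : {i : Fin n // i.val < k}, i.1 ∉ S → a i = b i := by
    simp only [cutEquiv, Equiv.piEquivPiSubtypeProd_symm_apply]
    constructor
    · intro h
      refine ⟨funext fun i => ?_, fun i hi => ?_⟩
      · have := h i.1 fun hi => i.2 (hS _ hi)
        simpa [i.2] using this
      · have := h i.1 hi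
        simpa [i.2] using this
    · rintro ⟨rfl, h⟩ i hi
      split_ifs with hik
      · exact h ⟨i, hik⟩ hi
      · rfl
  simp only [hiff]
  refine if_congr Iff.rfl ?_ rfl
  congr 1 <;>
  · funext i
    simp [cutEquiv, Equiv.piEquivPiSubtypeProd_symm_apply, hS i i.2]

theorem ActsOn.exists_split_eq_one_kronecker {S : Finset (Fin n)} {O : Op n d} (hO : ActsOn S O)
    {k : ℕ} (hS : ∀ i ∈ S, ¬ i.val < k) :
    ∃ Z : Matrix (RightConfig n d k) (RightConfig n d k) ℂ,
      split k O = (1 : Matrix (LeftConfig n d k) (LeftConfig n d k) ℂ) ⊗ₖ Z := by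
  obtain ⟨P, hP⟩ := hO
  refine ⟨Matrix.of fun a b => if ∀ i, i.1 ∉ S → a i = b i then
    P (fun i => a ⟨i, hS i i.2⟩) (fun i => b ⟨i, hS i i.2⟩) else 0, ?_⟩
  ext ⟨a, z⟩ ⟨b, w⟩
  rw [split, submatrix_apply, hP, kroneckerMap_apply, of_apply, Matrix.one_apply, ite_mul, one_mul,
    zero_mul, ← ite_and]
  have hiff : (∀ i, i ∉ S → (cutEquiv n d k).symm (a, z) i = (cutEquiv n d k).symm (b, w) i) ↔
      a = b ∧ ∀ i : {i : Fin n // ¬ i.val < k}, i.1 ∉ S → z i = w i := by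
    simp only [cutEquiv, Equiv.piEquivPiSubtypeProd_symm_apply]
    constructor
    · intro h
      refine ⟨funext fun i => ?_, fun i hi => ?_⟩
      · have := h i.1 fun hi => hS _ hi i.2
        simpa [i.2] using this
      · have := h i.1 hi
        simpa [i.2] using this
    · rintro ⟨rfl, h⟩ i hi
      split_ifs with hik
      · rfl
      · exact h ⟨i, hik⟩ hi
  simp only [hiff]
  refine if_congr Iff.rfl ?_ rfl
  congr 1 <;>
  · funext i
    simp [cutEquiv, Equiv.piEquivPiSubtypeProd_symm_apply, hS i i.2]

/-! ### Schmidt ranks -/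

theorem merge_eq_cutEquiv_symm (k : ℕ) (x z : Config n d) :
    merge k x z = (cutEquiv n d k).symm ((cutEquiv n d k x).1, (cutEquiv n d k z).2) := by
  funext i
  simp [merge, cutEquiv, Equiv.piEquivPiSubtypeProd]

theorem schmidtRankLE_of_fintype {ι : Type*} [Fintype ι] {k r : ℕ} (hr : Fintype.card ι = r)
    {X : Op n d} (F G : ι → Config n d → Config n d → ℂ)
    (h : ∀ x y z w, X (merge k x z) (merge k y w) = ∑ β, F β x y * G β z w) :
    SchmidtRankLE k r X := by
  subst hr
  let e := (Fintype.equivFin ι).symm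
  exact ⟨fun β => F (e β), fun β => G (e β), fun x y z w => by
    rw [h, ← e.sum_comp]⟩

/-- Both the row and the column index on the left pass through the `D` dimensions of `W`, hence the
square. -/
theorem schmidtRankLE_of_leftOp_conj {k D : ℕ} {X : Op n d}
    {W : Matrix (LeftConfig n d k) (Fin D) ℂ}
    (h : leftOp k (W * Wᴴ) * X * leftOp k (W * Wᴴ) = X) : SchmidtRankLE k (D * D) X := by
  refine schmidtRankLE_of_fintype (ι := Fin D × Fin D) (by simp)
    (fun β x y => W (cutEquiv n d k x).1 β.1 * Wᴴ β.2 (cutEquiv n d k y).1)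
    (fun β z w => ∑ a, ∑ b, Wᴴ β.1 a * W b β.2 *
      split k X (a, (cutEquiv n d k z).2) (b, (cutEquiv n d k w).2)) fun x y z w => ?_
  have h' := congrArg (split k) h
  rw [split_mul, split_mul, split_leftOp] at h'
  have e : X (merge k x z) (merge k y w) = split k X
      ((cutEquiv n d k x).1, (cutEquiv n d k z).2) ((cutEquiv n d k y).1, (cutEquiv n d k w).2) := by
    rw [merge_eq_cutEquiv_symm, merge_eq_cutEquiv_symm]; rfl
  rw [e]
  conv_lhs => rw [← h', kronecker_one_conj_apply]
  have hW : ∀ a' b', (W * Wᴴ) (cutEquiv n d k x).1 a' * (W * Wᴴ) b' (cutEquiv n d k y).1 =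
      ∑ β : Fin D × Fin D, W (cutEquiv n d k x).1 β.1 * Wᴴ β.1 a' *
        (W b' β.2 * Wᴴ β.2 (cutEquiv n d k y).1) := fun a' b' => by
    rw [Matrix.mul_apply, Matrix.mul_apply, Finset.sum_mul_sum, Fintype.sum_prod_type]
  simp only [hW, Finset.sum_mul, Finset.mul_sum]
  rw [← Fintype.sum_prod_type', Finset.sum_comm]
  refine Finset.sum_congr rfl fun β _ => ?_
  rw [Fintype.sum_prod_type]
  exact Finset.sum_congr rfl fun a' _ => Finset.sum_congr rfl fun b' _ => by ring

/-- A linear map on the first `k ≤ j` spins changes only the left factors in a decomposition at `j`.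
Thus truncations further left do not spoil a rank bound already obtained. -/
theorem SchmidtRankLE.of_left_map {k j r : ℕ} (hkj : k ≤ j) {X X' : Op n d}
    (hX : SchmidtRankLE j r X)
    {κ : LeftConfig n d k → LeftConfig n d k → LeftConfig n d k → LeftConfig n d k → ℂ}
    (hκ : ∀ a z b w, split k X' (a, z) (b, w) =
      ∑ a', ∑ b', κ a b a' b' * split k X (a', z) (b', w)) : SchmidtRankLE j r X' := by
  obtain ⟨F, G, hFG⟩ := hX
  let g : LeftConfig n d k → Config n d → Config n d := fun a x =>
    (cutEquiv n d k).symm (a, (cutEquiv n d k x).2)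
  refine ⟨fun β x y => ∑ a', ∑ b', κ (cutEquiv n d k x).1 (cutEquiv n d k y).1 a' b' *
    F β (g a' x) (g b' y), G, fun x y z w => ?_⟩
  have h1 : ∀ u : Config n d, (cutEquiv n d k).symm ((cutEquiv n d k u).1, (cutEquiv n d k u).2) = u :=
    fun u => (cutEquiv n d k).symm_apply_apply u
  have h2 : ∀ u v : Config n d, X' u v = split k X'
      ((cutEquiv n d k u).1, (cutEquiv n d k u).2) ((cutEquiv n d k v).1, (cutEquiv n d k v).2) := by
    intro u v
    rw [split, submatrix_apply, h1, h1]
  have h3 : ∀ x z : Config n d, (cutEquiv n d k (merge j x z)).1 = (cutEquiv n d k x).1 := by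
    intro x z
    funext i
    simp [cutEquiv, Equiv.piEquivPiSubtypeProd, merge, i.2.trans_le hkj]
  have h4 : ∀ (x z : Config n d) (a : LeftConfig n d k),
      (cutEquiv n d k).symm (a, (cutEquiv n d k (merge j x z)).2) = merge j (g a x) z := by
    intro x z a
    funext i
    simp only [g, cutEquiv, Equiv.piEquivPiSubtypeProd, merge, Equiv.coe_fn_mk, Equiv.coe_fn_symm_mk]
    by_cases hi : i.val < k
    · simp [hi, hi.trans_le hkj]
    · simp [hi]
  rw [h2, hκ, h3, h3]
  simp only [split, submatrix_apply, h4, hFG, Finset.mul_sum, Finset.sum_mul]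
  conv_rhs => rw [Finset.sum_comm]
  refine Finset.sum_congr rfl fun a' _ => ?_
  conv_rhs => rw [Finset.sum_comm]
  exact Finset.sum_congr rfl fun b' _ => Finset.sum_congr rfl fun β _ => (mul_assoc _ _ _).symm

end Cuts

/-! ### Truncating at all cuts with errors that stay local -/

section Truncation

variable {n d : ℕ}

theorem IsFilter.trace_compl_mul_le {A : Type*} [Fintype A] [DecidableEq A] {Λ P : Matrix A A ℂ}
    {ε c : ℝ} (hP : IsFilter Λ ε P c) {Y : Matrix A A ℂ} (hY : (Λ - Y).PosSemidef) :
    ((1 - P) * Y).trace.re ≤ ε := by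
  have hQH : (1 - P)ᴴ = 1 - P := by rw [conjTranspose_sub, conjTranspose_one, hP.isHermitian.eq]
  have hQQ : (1 - P) * (1 - P) = 1 - P := by
    rw [mul_sub, sub_mul, sub_mul, mul_one, one_mul, mul_one, hP.mul_self]; abel
  have h := (hY.mul_mul_conjTranspose_same (1 - P)).trace_nonneg
  rw [hQH, Matrix.trace_mul_comm, ← Matrix.mul_assoc, hQQ, mul_sub, Matrix.trace_sub] at h
  have h' := (Complex.nonneg_iff.1 h).1
  rw [Complex.sub_re] at h'
  linarith [hP.trace_compl_le]

theorem norm_trace_sub_trace_leftOp_conj_le {k : ℕ} {σ : Op n d} (hσ : σ.PosSemidef)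
    (hσ1 : σ.trace.re ≤ 1) {Λ P : Matrix (LeftConfig n d k) (LeftConfig n d k) ℂ} {ε c : ℝ}
    (hε : 0 < ε) (hε1 : ε ≤ 1) (hP : IsFilter Λ ε P c)
    (hle : (Λ - traceRight (split k σ)).PosSemidef) {O : Op n d} {M : ℝ} (hO : opNorm O ≤ M) :
    ‖(σ * O).trace - c * (leftOp k P * σ * leftOp k P * O).trace‖ ≤ 3 * M * Real.sqrt ε := by
  have hM : 0 ≤ M := (norm_nonneg _).trans hO
  have hs : 0 < Real.sqrt ε := Real.sqrt_pos.2 hε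
  have hεs : ε ≤ Real.sqrt ε := by
    rw [Real.le_sqrt' hε]; nlinarith
  have h0 := (Complex.nonneg_iff.1 hσ.trace_nonneg).1
  refine (norm_trace_sub_trace_conj_le hσ (leftOp_isHermitian hP.isHermitian)
    (leftOp_mul_self hP.mul_self) hP.le_one hs hO).trans ?_
  have h1 : ((1 - leftOp k P) * σ).trace.re ≤ ε := by
    rw [trace_one_sub_leftOp_mul]
    exact hP.trace_compl_mul_le hle
  have h2 : (Real.sqrt ε)⁻¹ * ((1 - leftOp k P) * σ).trace.re ≤ Real.sqrt ε := by
    calc _ ≤ (Real.sqrt ε)⁻¹ * ε := by gcongr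
      _ = Real.sqrt ε := by
        nth_rw 2 [← Real.mul_self_sqrt hε.le]
        rw [← mul_assoc, inv_mul_cancel₀ hs.ne', one_mul]
  have h3 : (Real.sqrt ε + (1 - c)) * σ.trace.re ≤ 2 * Real.sqrt ε := by
    have h4 : Real.sqrt ε + (1 - c) ≤ 2 * Real.sqrt ε := by linarith [hP.one_sub_le]
    have h5 : 0 ≤ Real.sqrt ε + (1 - c) := by linarith [hP.le_one]
    nlinarith
  calc _ ≤ M * (Real.sqrt ε + 2 * Real.sqrt ε) :=
        mul_le_mul_of_nonneg_left (add_le_add h2 h3) hM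
    _ = _ := by ring

/-- A truncation of the state at a cut which keeps local expectation values, is invisible for
operators to the right of the cut, and resets the state to the left of the cut. -/
theorem exists_truncation_at_cut {k : ℕ} {X : Op n d} (hX : X.PosSemidef)
    {Λ P : Matrix (LeftConfig n d k) (LeftConfig n d k) ℂ} {ε c : ℝ} (hε : 0 < ε) (hε1 : ε ≤ 1)
    (hP : IsFilter Λ ε P c) (hle : (Λ - traceRight (split k X)).PosSemidef)
    (htr : X.trace = ((1 - ε : ℝ) : ℂ)) :
    ∃ X' : Op n d, X'.PosSemidef ∧ traceRight (split k X') = (c : ℂ) • (P * Λ * P) ∧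
      (∀ (O : Op n d) (M : ℝ), opNorm O ≤ M →
        ‖(X' * O).trace - (X * O).trace‖ ≤ 5 * M * Real.sqrt ε) ∧
      (∀ (O : Op n d) (Z : Matrix (RightConfig n d k) (RightConfig n d k) ℂ),
        split k O = (1 : Matrix (LeftConfig n d k) (LeftConfig n d k) ℂ) ⊗ₖ Z →
        (X' * O).trace = (X * O).trace) ∧
      leftOp k P * X' * leftOp k P = X' ∧
      ∀ j r, k ≤ j → SchmidtRankLE j r X → SchmidtRankLE j r X' := by
  obtain ⟨Y, hY1, hY2, hY3, hY4, κ, hκ⟩ := exists_truncation ((posSemidef_split_iff k).2 hX)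
    hP.isHermitian hP.mul_self hP.nonneg hP.le_one hle
    (by rw [hP.trace_eq, trace_split, htr])
  obtain ⟨X', rfl⟩ : ∃ X' : Op n d, Y = split k X' := ⟨unsplit k Y, (split_unsplit k Y).symm⟩
  have hR : (X' - (c : ℂ) • (leftOp k P * X * leftOp k P)).PosSemidef := by
    rw [← posSemidef_split_iff k, split_sub, split_smul, split_mul, split_mul, split_leftOp]
    exact hY2
  have hX' : X'.PosSemidef := by
    have h1 : ((c : ℂ) • (leftOp k P * X * leftOp k P)).PosSemidef := by
      have := (hX.mul_mul_conjTranspose_same (leftOp k P)).smul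
        (show (0 : ℂ) ≤ (c : ℂ) by exact_mod_cast hP.nonneg)
      rwa [(leftOp_isHermitian hP.isHermitian).eq] at this
    have := hR.add h1
    rwa [sub_add_cancel] at this
  have htr' : X'.trace = ((1 - ε : ℝ) : ℂ) := by
    rw [← trace_split k, ← trace_traceRight, hY1, Matrix.trace_smul, Matrix.trace_mul_comm,
      ← Matrix.mul_assoc, hP.mul_self, smul_eq_mul, hP.trace_eq]
  refine ⟨X', hX', hY1, fun O M hO => ?_, fun O Z hO => ?_, ?_, fun j r hj hr => hr.of_left_map hj hκ⟩
  · have hM : 0 ≤ M := (norm_nonneg _).trans hO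
    have hεs : ε ≤ Real.sqrt ε := by
      rw [Real.le_sqrt' hε]; nlinarith
    have h1 := norm_trace_sub_trace_leftOp_conj_le hX
      (by rw [htr, Complex.ofReal_re]; linarith) hε hε1 hP hle hO
    have h2 := norm_trace_mul_le hR hO
    -- The added product operator has trace `(1 - c) (1 - ε)` plus `c` times the weight of `X`
    -- outside `P`; both terms are at most `ε`. Together with the `3 M √ε` of gentle measurement
    -- this gives the constant 5.
    have h3 : (X' - (c : ℂ) • (leftOp k P * X * leftOp k P)).trace.re ≤ 2 * ε := by
      have h4 : ((1 - leftOp k P) * X).trace.re ≤ ε := by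
        rw [trace_one_sub_leftOp_mul]
        exact hP.trace_compl_mul_le hle
      have h5 : (leftOp k P * X * leftOp k P).trace =
          X.trace - ((1 - leftOp k P) * X).trace := by
        rw [Matrix.trace_mul_comm, ← Matrix.mul_assoc, leftOp_mul_self hP.mul_self, sub_mul, one_mul,
          Matrix.trace_sub, sub_sub_cancel]
      rw [Matrix.trace_sub, Matrix.trace_smul, h5, htr, htr', smul_eq_mul, Complex.sub_re,
        Complex.re_ofReal_mul, Complex.sub_re, Complex.ofReal_re]
      nlinarith [hP.one_sub_le, hP.le_one, hP.nonneg]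
    have h6 : (X' * O).trace - (X * O).trace =
        ((X' - (c : ℂ) • (leftOp k P * X * leftOp k P)) * O).trace -
        ((X * O).trace - c * (leftOp k P * X * leftOp k P * O).trace) := by
      rw [sub_mul, Matrix.trace_sub, Matrix.smul_mul, Matrix.trace_smul, smul_eq_mul]
      ring
    rw [h6]
    refine (norm_sub_le _ _).trans ?_
    have h7 : M * (X' - (c : ℂ) • (leftOp k P * X * leftOp k P)).trace.re ≤
        M * (2 * Real.sqrt ε) := mul_le_mul_of_nonneg_left (by linarith) hM
    linarith
  · rw [← trace_split k, split_mul, hO, hY4, ← hO, ← split_mul, trace_split]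
  · apply split_injective k
    rw [split_mul, split_mul, split_leftOp]
    exact hY3

/-- The expectation value of an operator to the left of a cut in a state whose reduced density
matrix is truncated there. -/
theorem norm_trace_sub_expect_le_of_traceRight_eq {k : ℕ} {ψ : State n d} (hψ : ‖ψ‖ = 1)
    {P : Matrix (LeftConfig n d k) (LeftConfig n d k) ℂ} {ε c : ℝ} (hε : 0 < ε) (hε1 : ε ≤ 1)
    (hP : IsFilter (reducedDensity ψ k) ε P c) {X : Op n d}
    (hX : traceRight (split k X) = (c : ℂ) • (P * reducedDensity ψ k * P)) {O : Op n d} {M : ℝ}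
    (hO : opNorm O ≤ M) {Y : Matrix (LeftConfig n d k) (LeftConfig n d k) ℂ}
    (hOY : split k O = Y ⊗ₖ (1 : Matrix (RightConfig n d k) (RightConfig n d k) ℂ)) :
    ‖(X * O).trace - expect ψ O‖ ≤ 3 * M * Real.sqrt ε := by
  have h : (X * O).trace = c * (leftOp k P * density ψ * leftOp k P * O).trace := by
    rw [← trace_split k (X * O), ← trace_split k (_ * O), split_mul, split_mul _ _ O, hOY,
      trace_mul_kronecker_one, trace_mul_kronecker_one, hX, split_mul, split_mul, split_leftOp,
      traceRight_conj, ← reducedDensity_eq_traceRight, Matrix.smul_mul, Matrix.trace_smul,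
      smul_eq_mul]
  rw [h, expect_eq_trace, norm_sub_rev]
  refine norm_trace_sub_trace_leftOp_conj_le (posSemidef_density ψ)
    (by rw [trace_density hψ, Complex.one_re]) hε hε1 hP ?_ hO
  rw [← reducedDensity_eq_traceRight, sub_self]
  exact PosSemidef.zero

/-- Truncating at all cuts, from right to left. -/
theorem exists_locally_close_of_isFilter {ψ : State n d} (hψ : ‖ψ‖ = 1) {ε : ℝ} (hε : 0 < ε)
    (hε1 : ε < 1) (ℓ : ℕ) (D : ℕ → ℕ)
    (h : ∀ k, ∃ (P : Matrix (LeftConfig n d k) (LeftConfig n d k) ℂ) (c : ℝ),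
      IsFilter (reducedDensity ψ k) ε P c ∧ (0 < k → k < n →
        ∃ W : Matrix (LeftConfig n d k) (Fin (D k)) ℂ, P = W * Wᴴ)) :
    ∃ X : Op n d, X.PosSemidef ∧ (∀ k, 0 < k → k < n → SchmidtRankLE k (D k * D k) X) ∧
      ∀ (O : Op n d) (M : ℝ), IsLocal ℓ O → opNorm O ≤ M →
        ‖expect ψ O - (X * O).trace‖ ≤ (1 + ℓ) * (5 * M * Real.sqrt ε) := by
  choose P c hP hW using h
  -- In the error factor, 1 pays for the reset at a cut to the right of the support, and `a + ℓ -
  -- max k a` counts the cuts `j` with `k ≤ j` and `a ≤ j < a + ℓ` treated so far.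
  have main : ∀ k, k ≤ n → ∃ (X : Op n d) (P' : Matrix (LeftConfig n d k) (LeftConfig n d k) ℂ)
      (c' : ℝ), IsFilter (reducedDensity ψ k) ε P' c' ∧ X.PosSemidef ∧
      traceRight (split k X) = (c' : ℂ) • (P' * reducedDensity ψ k * P') ∧
      (∀ j, k ≤ j → 0 < j → j < n → SchmidtRankLE j (D j * D j) X) ∧
      ∀ (a : ℕ) (O : Op n d) (M : ℝ),
        ActsOn (Finset.univ.filter fun i : Fin n => a ≤ i.val ∧ i.val < a + ℓ) O → opNorm O ≤ M →
        ‖(X * O).trace - expect ψ O‖ ≤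
          (1 + ((a + ℓ - max k a : ℕ) : ℝ)) * (5 * M * Real.sqrt ε) := by
    -- Operators to the left of the current cut see only the reset marginal, so their error does not
    -- depend on earlier truncations. The minimum with `n` allows windows that stick out of the
    -- chain.
    have left : ∀ (k : ℕ) (X : Op n d) (P' : Matrix (LeftConfig n d k) (LeftConfig n d k) ℂ)
        (c' : ℝ), IsFilter (reducedDensity ψ k) ε P' c' →
        traceRight (split k X) = (c' : ℂ) • (P' * reducedDensity ψ k * P') →
        ∀ (a : ℕ) (O : Op n d) (M : ℝ),
        ActsOn (Finset.univ.filter fun i : Fin n => a ≤ i.val ∧ i.val < a + ℓ) O → opNorm O ≤ M →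
        min n (a + ℓ) ≤ k → ‖(X * O).trace - expect ψ O‖ ≤
          (1 + ((a + ℓ - max k a : ℕ) : ℝ)) * (5 * M * Real.sqrt ε) := by
      intro k X P' c' hP' hX a O M hO hM hk
      have hM0 : 0 ≤ M := (norm_nonneg _).trans hM
      obtain ⟨Y, hY⟩ := hO.exists_split_eq_kronecker_one (k := k) fun i hi => by
        have h1 := (Finset.mem_filter.1 hi).2.2
        have h2 := i.2
        omega
      have h1 := norm_trace_sub_expect_le_of_traceRight_eq hψ hε hε1.le hP' hX hM hY
      have h2 : 0 ≤ M * Real.sqrt ε := by positivity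
      have h3 : (0 : ℝ) ≤ ((a + ℓ - max k a : ℕ) : ℝ) := Nat.cast_nonneg _
      nlinarith [mul_nonneg h3 h2]
    intro k hk
    induction hk using Nat.decreasingInduction with
    | self =>
      have hF := isFilter_one (posSemidef_reducedDensity ψ n) (trace_reducedDensity hψ n) hε hε1
      have hred : traceRight (split n (((1 - ε : ℝ) : ℂ) • density ψ)) =
          ((1 - ε : ℝ) : ℂ) • (1 * reducedDensity ψ n * 1) := by
        rw [split_smul, traceRight_smul, one_mul, mul_one, reducedDensity_eq_traceRight]
      exact ⟨((1 - ε : ℝ) : ℂ) • density ψ, 1, 1 - ε, hF,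
        (posSemidef_density ψ).smul (by exact_mod_cast hF.nonneg), hred,
        fun j hj _ hjn => absurd hjn hj.not_gt,
        fun a O M hO hM => left n _ 1 (1 - ε) hF hred a O M hO hM (min_le_left _ _)⟩
    | of_succ k hk ih =>
      obtain ⟨X, P', c', hP', hXpos, hXred, hXrank, hXloc⟩ := ih
      have htr : X.trace = ((1 - ε : ℝ) : ℂ) := by
        rw [← trace_split (k + 1), ← trace_traceRight, hXred, Matrix.trace_smul,
          Matrix.trace_mul_comm, ← Matrix.mul_assoc, hP'.mul_self, smul_eq_mul, hP'.trace_eq]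
      -- The domination `c' P' ρ P' ≤ ρ` at cut `k + 1` survives tracing out spin `k`.
      have hle : (reducedDensity ψ k - traceRight (split k X)).PosSemidef := by
        rw [reducedDensity_eq_traceRight, ← traceRight_sub, ← split_sub]
        apply posSemidef_traceRight_split_of_succ hk
        rw [split_sub, traceRight_sub, ← reducedDensity_eq_traceRight, hXred]
        exact hP'.posSemidef_sub
      obtain ⟨X', hpos, hred, hnorm, hright, hproj, hrank⟩ :=
        exists_truncation_at_cut hXpos hε hε1.le (hP k) hle htr
      refine ⟨X', P k, c k, hP k, hpos, hred, fun j hj hj0 hjn => ?_, fun a O M hO hM => ?_⟩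
      · rcases hj.eq_or_lt with rfl | hlt
        · obtain ⟨W, hWk⟩ := hW k hj0 hjn
          rw [hWk] at hproj
          exact schmidtRankLE_of_leftOp_conj hproj
        · exact hrank j _ hj (hXrank j hlt hj0 hjn)
      · by_cases hka : a + ℓ ≤ k
        · exact left k X' (P k) (c k) (hP k) hred a O M hO hM ((min_le_right _ _).trans hka)
        · have ih := hXloc a O M hO hM
          by_cases hak : a ≤ k
          · have hcount : a + ℓ - max k a = (a + ℓ - max (k + 1) a) + 1 := by omega
            have h1 := norm_add_le ((X' * O).trace - (X * O).trace) ((X * O).trace - expect ψ O)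
            rw [sub_add_sub_cancel] at h1
            have h2 := hnorm O M hM
            rw [hcount]
            push_cast
            linarith
          · obtain ⟨Z, hZ⟩ := hO.exists_split_eq_one_kronecker (k := k) fun i hi => by
              have := (Finset.mem_filter.1 hi).2.1
              omega
            have hcount : max k a = max (k + 1) a := by omega
            rwa [hright O Z hZ, hcount]
  obtain ⟨X, -, -, -, hpos, -, hrank, hloc⟩ := main 0 (Nat.zero_le n)
  refine ⟨X, hpos, fun k hk hkn => hrank k (Nat.zero_le k) hk hkn, fun O M ⟨a, hO⟩ hM => ?_⟩
  have := hloc a O M hO hM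
  rw [norm_sub_rev]
  simpa using this

end Truncation

/-! ### From area laws to bond dimensions -/

section Approximation

variable {n d : ℕ}

/-- On the empty chain the only state is represented exactly. -/
theorem exists_MPO_of_chain_empty {ψ : State 0 d} (hψ : ‖ψ‖ = 1) :
    ∃ K : MPO 0 d, K.bond = (fun _ => 1) ∧ K.toOp = density ψ := by
  refine ⟨⟨fun _ => 1, fun _ _ => one_pos, rfl, rfl, fun k => k.elim0⟩, rfl, ?_⟩
  have h := trace_density hψ
  ext x y
  obtain rfl := Subsingleton.elim x y
  rw [Matrix.trace, Fintype.sum_subsingleton _ x, diag_apply] at h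
  rw [h]
  rfl

theorem exists_MPO_of_renyiAreaLaw {ψ : State n d} (hψ : ‖ψ‖ = 1) {α R ε : ℝ} (hα0 : 0 < α)
    (hα1 : α < 1) (hR0 : 0 ≤ R) (hR : RenyiAreaLaw α R ψ) (hε : 0 < ε) (hε1 : ε < 1) (ℓ : ℕ) :
    ∃ ρ : MPO n d, (ρ.bondDim : ℝ) ≤ (Real.exp R * (1 / ε) ^ (α / (1 - α))) ^ 2 ∧
      ρ.toOp.PosSemidef ∧
      ∀ (O : Op n d) (M : ℝ), IsLocal ℓ O → opNorm O ≤ M →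
        ‖expect ψ O - (ρ.toOp * O).trace‖ ≤ (1 + ℓ) * (5 * M * Real.sqrt ε) := by
  set B := Real.exp R * (1 / ε) ^ (α / (1 - α)) with hB
  have hB1 : 1 ≤ B := by
    have h1 : 1 ≤ Real.exp R := Real.one_le_exp hR0
    have h2 : 1 ≤ (1 / ε) ^ (α / (1 - α)) :=
      Real.one_le_rpow ((one_le_div hε).2 hε1.le) (div_nonneg hα0.le (by linarith))
    nlinarith
  rcases Nat.eq_zero_or_pos n with rfl | hn
  · obtain ⟨K, hK, hKψ⟩ := exists_MPO_of_chain_empty hψ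
    refine ⟨K, ?_, hKψ ▸ posSemidef_density ψ, fun O M _ hM => ?_⟩
    · have : K.bondDim ≤ 1 := Finset.sup_le fun k _ => by rw [hK]
      have h2 : (K.bondDim : ℝ) ≤ 1 := by exact_mod_cast this
      nlinarith
    · have hM0 : 0 ≤ M := (norm_nonneg _).trans hM
      rw [hKψ, expect_eq_trace, sub_self, norm_zero]
      positivity
  -- Without configurations (`d = 0`) there would be no unit vector.
  have hne : Nonempty (Config n d) := by
    by_contra h
    rw [not_nonempty_iff] at h
    have := trace_density hψ
    simp [Matrix.trace] at this
  have key : ∀ k, ∃ (D : ℕ) (P : Matrix (LeftConfig n d k) (LeftConfig n d k) ℂ) (c : ℝ),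
      (0 < D ∧ (D : ℝ) ≤ B) ∧ IsFilter (reducedDensity ψ k) ε P c ∧ (0 < k → k < n →
        ∃ W : Matrix (LeftConfig n d k) (Fin D) ℂ, P = W * Wᴴ) := by
    intro k
    by_cases hk : 0 < k ∧ k < n
    · obtain ⟨P, c, hP, D, hD0, hD, hW⟩ := exists_isFilter (posSemidef_reducedDensity ψ k)
        (trace_reducedDensity hψ k) hα0 hα1 (hR k hk.1 hk.2) hε hε1
      exact ⟨D, P, c, ⟨hD0, hD⟩, hP, fun _ _ => hW⟩
    · exact ⟨1, 1, 1 - ε, ⟨one_pos, by exact_mod_cast hB1⟩,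
        isFilter_one (posSemidef_reducedDensity ψ k) (trace_reducedDensity hψ k) hε hε1,
        fun h h' => absurd ⟨h, h'⟩ hk⟩
  choose D hD using key
  choose P c hDB hP using hD
  obtain ⟨X, hX, hrank, hloc⟩ := exists_locally_close_of_isFilter hψ hε hε1 ℓ D
    fun k => ⟨P k, c k, hP k⟩
  let r : ℕ → ℕ := fun k => if 0 < k ∧ k < n then D k * D k else 1
  have hr : ∀ k, 0 < r k ∧ (r k : ℝ) ≤ B ^ 2 := by
    intro k
    simp only [r]
    split_ifs
    · refine ⟨Nat.mul_pos (hDB k).1 (hDB k).1, ?_⟩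
      rw [Nat.cast_mul, ← sq]
      exact pow_le_pow_left₀ (Nat.cast_nonneg _) (hDB k).2 2
    · exact ⟨one_pos, by rw [Nat.cast_one]; exact one_le_pow₀ hB1⟩
  obtain ⟨K, hKr, hKX⟩ := exists_MPO_of_schmidtRankLE hn X r (fun k => (hr k).1) (by simp [r])
    (by simp [r]) fun k hk hkn => by
      have : r k = D k * D k := if_pos ⟨hk, hkn⟩
      rw [this]; exact hrank k hk hkn
  refine ⟨K, ?_, hKX ▸ hX, hKX ▸ hloc⟩
  obtain ⟨k, -, hk⟩ := Finset.exists_mem_eq_sup (Finset.range (n + 1)) ⟨0, by simp⟩ K.bond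
  rw [MPO.bondDim, hk, hKr]
  exact (hr k).2

theorem exists_MPO_approximatesLocally (d ℓ : ℕ) (M : ℝ) :
    ∃ C : ℝ, 1 ≤ C ∧ ∀ (α R : ℝ), 0 < α → α < 1 → 0 ≤ R →
      ∀ (n : ℕ) (ψ : State n d), ‖ψ‖ = 1 → RenyiAreaLaw α R ψ →
      ∀ δ : ℝ, 0 < δ → δ ≤ 1 →
        ∃ ρ : MPO n d,
          (ρ.bondDim : ℝ) ≤ Real.exp (2 * R) * (C / δ) ^ (4 * α / (1 - α)) ∧
          ρ.toOp.PosSemidef ∧ ρ.ApproximatesLocally ψ ℓ M δ := by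
  -- With `√ε = δ / C` the error `(1 + ℓ) * (5 * M * √ε)` is at most `δ`. The summand 1 next to
  -- `|M|` ensures `C ≥ 5`, hence `ε < 1`, for every real `M`.
  set C : ℝ := 5 * (ℓ + 1) * (|M| + 1) with hC
  have hC5 : 5 ≤ C := by
    have h1 : (0 : ℝ) ≤ ℓ := Nat.cast_nonneg ℓ
    have h2 := abs_nonneg M
    nlinarith [mul_nonneg h1 h2]
  refine ⟨C, by linarith, fun α R hα0 hα1 hR0 n ψ hψ hR δ hδ hδ1 => ?_⟩
  have hCpos : 0 < C := by linarith
  have hδC : 0 < δ / C := div_pos hδ hCpos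
  have hδC1 : δ / C < 1 := by rw [div_lt_one hCpos]; linarith
  obtain ⟨ρ, hρ, hpos, hloc⟩ := exists_MPO_of_renyiAreaLaw hψ hα0 hα1 hR0 hR
    (ε := (δ / C) ^ 2) (by positivity) (by nlinarith) ℓ
  refine ⟨ρ, hρ.trans_eq ?_, hpos, fun O hO hM => (hloc O M hO hM).trans ?_⟩
  · have hCδ : 0 ≤ C / δ := (div_pos hCpos hδ).le
    have e : 1 / (δ / C) ^ 2 = (C / δ) ^ (2 : ℝ) := by
      rw [Real.rpow_two]; field_simp
    rw [e, ← Real.rpow_mul hCδ, mul_pow, ← Real.exp_nat_mul, ← Real.rpow_natCast (_ ^ _),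
      ← Real.rpow_mul hCδ]
    push_cast
    congr 2
    ring
  · rw [Real.sqrt_sq hδC.le]
    have h1 : (1 + (ℓ : ℝ)) * (5 * M * (δ / C)) = (5 * (ℓ + 1) * M) / C * δ := by ring
    have h2 : 5 * ((ℓ : ℝ) + 1) * M ≤ C := by
      rw [hC]
      have := le_abs_self M
      gcongr
      linarith
    rw [h1]
    exact mul_le_of_le_one_left hδ.le ((div_le_one hCpos).2 h2)

theorem isLittleO_rpow_rpow_atTop {a b : ℝ} (hab : a < b) :
    (fun t : ℝ => t ^ a) =o[Filter.atTop] fun t : ℝ => t ^ b := by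
  rw [Asymptotics.isLittleO_iff_tendsto']
  · refine (tendsto_rpow_neg_atTop (sub_pos.2 hab)).congr' ?_
    filter_upwards [Filter.eventually_gt_atTop 0] with t ht
    rw [← Real.rpow_sub ht, neg_sub]
  · filter_upwards [Filter.eventually_gt_atTop 0] with t ht h
    exact absurd h (Real.rpow_pos_of_pos ht b).ne'

/-- If a family of functions is bounded by powers with arbitrarily small exponents, its infimum
grows subpolynomially. -/
theorem exists_subpolynomial_bound {ι : Type*} [Nonempty ι] (f : ι → ℝ → ℝ)
    (hf0 : ∀ i t, 0 < t → 0 ≤ f i t)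
    (hf : ∀ c : ℝ, 0 < c → ∃ i, f i =o[Filter.atTop] fun t : ℝ => t ^ c) :
    ∃ B : ℝ → ℝ, (∀ c : ℝ, 0 < c → B =o[Filter.atTop] fun t : ℝ => t ^ c) ∧
      ∀ t, 0 < t → ∃ i, f i t ≤ B t := by
  -- The infimum need not be attained; adding 1 leaves room for an index that lies below the bound
  -- and does not affect subpolynomial growth.
  refine ⟨fun t => (⨅ i, f i t) + 1, fun c hc => ?_, fun t ht => ?_⟩
  · refine Asymptotics.IsLittleO.add ?_ ?_
    · obtain ⟨i, hi⟩ := hf c hc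
      refine Asymptotics.IsBigO.trans_isLittleO (Asymptotics.IsBigO.of_bound 1 ?_) hi
      filter_upwards [Filter.eventually_gt_atTop 0] with t ht
      have hbdd : BddBelow (Set.range fun i => f i t) :=
        ⟨0, by rintro _ ⟨j, rfl⟩; exact hf0 j t ht⟩
      rw [one_mul, Real.norm_of_nonneg (Real.iInf_nonneg fun j => hf0 j t ht),
        Real.norm_of_nonneg (hf0 i t ht)]
      exact ciInf_le hbdd i
    · exact (Asymptotics.isLittleO_const_left.2 (Or.inr
        (Filter.tendsto_abs_atTop_atTop.comp (tendsto_rpow_atTop hc))))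
  · obtain ⟨i, hi⟩ := exists_lt_of_ciInf_lt (lt_add_one (⨅ i, f i t))
    exact ⟨i, hi.le⟩

end Approximation

end SpinChain

end

theorem mainTheorem4 (d ℓ : ℕ) (M : ℝ) :
    -- the bound for a single order `α`
    (∃ C : ℝ, 0 < C ∧
      ∀ (α R : ℝ), 0 < α → α < 1 → 0 ≤ R →
      ∀ (n : ℕ) (ψ : SpinChain.State n d), ‖ψ‖ = 1 → SpinChain.RenyiAreaLaw α R ψ →
      ∀ δ : ℝ, 0 < δ → δ ≤ 1 →
        ∃ ρ : SpinChain.MPO n d,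
          (ρ.bondDim : ℝ) ≤ Real.exp (2 * R) * (C / δ) ^ (4 * α / (1 - α)) ∧
          ρ.toOp.PosSemidef ∧
          ρ.ApproximatesLocally ψ ℓ M δ) ∧
    -- area laws for all orders: a bound independent of `n` and subpolynomial in `1 / δ`
    (∀ R : ℝ → ℝ, (∀ α : ℝ, 0 < α → α < 1 → 0 ≤ R α) →
      ∃ B : ℝ → ℝ,
        (∀ c : ℝ, 0 < c → B =o[Filter.atTop] fun t : ℝ => t ^ c) ∧
        ∀ (n : ℕ) (ψ : SpinChain.State n d), ‖ψ‖ = 1 →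
          (∀ α : ℝ, 0 < α → α < 1 → SpinChain.RenyiAreaLaw α (R α) ψ) →
        ∀ δ : ℝ, 0 < δ → δ ≤ 1 →
          ∃ ρ : SpinChain.MPO n d,
            (ρ.bondDim : ℝ) ≤ B (1 / δ) ∧
            ρ.toOp.PosSemidef ∧
            ρ.ApproximatesLocally ψ ℓ M δ) := by
  obtain ⟨C, hC, hmain⟩ := SpinChain.exists_MPO_approximatesLocally d ℓ M
  have hC0 : 0 < C := by linarith
  refine ⟨⟨C, hC0, hmain⟩, fun R hR => ?_⟩
  have hne : Nonempty (Set.Ioo (0 : ℝ) 1) := ⟨⟨1 / 2, by norm_num, by norm_num⟩⟩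
  obtain ⟨B, hB, hle⟩ := SpinChain.exists_subpolynomial_bound
    (fun (α : Set.Ioo (0 : ℝ) 1) (t : ℝ) =>
      Real.exp (2 * R α) * (C * t) ^ (4 * (α : ℝ) / (1 - α)))
    (fun α t ht => by positivity) (fun c hc => by
      -- This `α` solves `4 α / (1 - α) = c / 2`, an exponent strictly below `c`.
      have hα : c / (8 + c) ∈ Set.Ioo (0 : ℝ) 1 :=
        ⟨by positivity, by rw [div_lt_one (by positivity)]; linarith⟩
      refine ⟨⟨c / (8 + c), hα⟩, ?_⟩
      have he : 4 * (c / (8 + c)) / (1 - c / (8 + c)) = c / 2 := by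
        have h8 : 8 + c ≠ 0 := by positivity
        have : 1 - c / (8 + c) = 8 / (8 + c) := by field_simp; ring
        rw [this]; field_simp; norm_num
      simp only [he]
      refine Asymptotics.IsLittleO.const_mul_left ?_ _
      have h1 : (fun t : ℝ => (C * t) ^ (c / 2)) =ᶠ[Filter.atTop]
          fun t => C ^ (c / 2) * t ^ (c / 2) := by
        filter_upwards [Filter.eventually_ge_atTop 0] with t ht
        exact Real.mul_rpow hC0.le ht
      exact h1.trans_isLittleO
        ((SpinChain.isLittleO_rpow_rpow_atTop (by linarith)).const_mul_left _))
  refine ⟨B, hB, fun n ψ hψ hψR δ hδ hδ1 => ?_⟩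
  obtain ⟨⟨α, hα0, hα1⟩, hα⟩ := hle (1 / δ) (by positivity)
  obtain ⟨ρ, hρ, hρ'⟩ := hmain α (R α) hα0 hα1 (hR α hα0 hα1) n ψ hψ (hψR α hα0 hα1) δ hδ hδ1
  refine ⟨ρ, hρ.trans ?_, hρ'⟩
  rwa [mul_one_div] at hα
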